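/- Let $w$ be Gaussian white noise on $(0,1)$ and let $\phi_1,\phi_2,\dots$ be an orthonormal system in $L_2(0,1)$. For $\varepsilon>0$ and $S\in L_2(0,1)$ we observe $dY_\varepsilon=S\,dt+\varepsilon\,dw$, so that $y_{\varepsilon j}=\int_0^1\phi_j\,dY_\varepsilon=\theta_j+\varepsilon\xi_j$, where $\theta_j=\int_0^1S\phi_j\,dt$ and $\xi_j=\int_0^1\phi_j\,dw$, $j\ge1$. Let $\varkappa_{\varepsilon j}$ be real numbers with $\rho_\varepsilon^2=\sum_{j\ge1}\varkappa_{\varepsilon j}^2<\infty$, and put $$A_\varepsilon=\varepsilon^{-4}\sum_{j\ge1}\varkappa_{\varepsilon j}^4,\quad k_\varepsilon=\sup\Bigl\{k\ge1:\sum_{1\le j<k}\varkappa_{\varepsilon j}^2\le\tfrac12\rho_\varepsilon^2\Bigr\},\quad \varkappa_\varepsilon^2=\varkappa_{\varepsilon k_\varepsilon}^2,$$ $$T_\varepsilon=\varepsilon^{-2}\sum_{j\ge1}\varkappa_{\varepsilon j}^2y_{\varepsilon j}^2-\rho_\varepsilon^2,\quad D_\varepsilon(S)=\varepsilon^{-4}\sum_{j\ge1}\varkappa_{\varepsilon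 j}^2\theta_j^2,\quad B_\varepsilon(S)=\frac{D_\varepsilon(S)}{(2A_\varepsilon)^{1/2}}.$$ For a family of thresholds $x_\varepsilon\in\mathbb R$ let $L_\varepsilon=\mathbf 1\{\varepsilon^{-2}(2A_\varepsilon)^{-1/2}T_\varepsilon>x_\varepsilon\}$, and let $\alpha(L_\varepsilon)=\mathbf E_0L_\varepsilon$ and $\beta(L_\varepsilon,S)=\mathbf E_S(1-L_\varepsilon)$ be its type I and type II error probabilities. Let $\Phi$ be the standard normal distribution function and $[a]$ the integer part of $a$. Assume: A1. For each $\varepsilon>0$ the sequence $(\varkappa_{\varepsilon j}^2)_{j\ge1}$ is nonincreasing. A2. There are constants $0<C_1<C_2$ with $C_1<A_\varepsilon<C_2$ for all $\varepsilon>0$. A3. There are $C_1$ and $\lambda>1$ such that $\varkappa^2_{\varepsilon,[(1+\delta)k_\varepsilon]}<C_1(1+\delta)^{-\lambda}\varkappa_\varepsilon^2$ for all $\delta>0$, $\varepsilon>0$. A4. $\varkappa_{\varepsilon1}^2\asymp\varkappa_\varepsilon^2$ as $\varepsilon\to0$, and for every $c>1$ there is $C>0$ with $\varkappa^2_{\varepsilon,[ck_\varepsilon]}\ge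 C\varkappa_\varepsilon^2$ for all $\varepsilon>0$. All limits are as $\varepsilon\to0$, $\varepsilon>0$. For families of reals, in conditions 2, 4 and 5, $f_\varepsilon=O(g_\varepsilon)$ means that $f_\varepsilon\le Cg_\varepsilon$ for some constant $C>0$ and all small $\varepsilon$, and $f_\varepsilon=\Omega(g_\varepsilon)$ means $g_\varepsilon=O(f_\varepsilon)$. Let $S_\varepsilon\in L_2(0,1)$, $\varepsilon>0$, and write $B_\varepsilon=B_\varepsilon(S_\varepsilon)$, $D_\varepsilon=D_\varepsilon(S_\varepsilon)$. Then: 1. If $x_\varepsilon\to\infty$ and $x_\varepsilon=o(k_\varepsilon^{1/6})$, then $\alpha(L_\varepsilon)=(1-\Phi(x_\varepsilon))(1+o(1))$. 2. If $\alpha(L_\varepsilon)\to0$, $x_\varepsilon=O(B_\varepsilon)$, $D_\varepsilon\to\infty$, $D_\varepsilon=o(k_\varepsilon^{1/6})$ and $B_\varepsilon-x_\varepsilon=\Omega(B_\varepsilon)$, then $\beta(L_\varepsilon,S_\varepsilon)=\Phi(x_\varepsilon-B_\varepsilon)(1+o(1))$. 3. If $x_\varepsilon\to\infty$ and $x_\varepsilon=o(k_\varepsilon^{1/2})$,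 then $\sqrt{2|\log\alpha(L_\varepsilon)|}=x_\varepsilon(1+o(1))$ and $\alpha(L_\varepsilon)\to0$. 4. If $\alpha(L_\varepsilon)\to0$, $x_\varepsilon=O(B_\varepsilon)$, $D_\varepsilon\to\infty$, $D_\varepsilon=o(k_\varepsilon^{1/2})$ and $B_\varepsilon-x_\varepsilon=\Omega(B_\varepsilon)$, then $\sqrt{2|\log\beta(L_\varepsilon,S_\varepsilon)|}=(B_\varepsilon-x_\varepsilon)(1+o(1))$. 5. If $\alpha(L_\varepsilon)\to0$, $x_\varepsilon=O(B_\varepsilon)$, $r_\varepsilon\to\infty$, $r_\varepsilon=O(k_\varepsilon^{1/2})$, $B_\varepsilon/r_\varepsilon\to\infty$ and $B_\varepsilon-x_\varepsilon=\Omega(B_\varepsilon)$, then $r_\varepsilon^{-2}|\log\beta(L_\varepsilon,S_\varepsilon)|\to\infty$. -/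

import Mathlib

open MeasureTheory ProbabilityTheory Filter Topology Asymptotics

noncomputable section

namespace NeymanTest

/-- The space `L₂(0,1)` of signals. -/
abbrev Signal : Type := Lp ℝ 2 (volume.restrict (Set.Ioo (0 : ℝ) 1))

/-- Gaussian white noise on `(0,1)`: `W f` is the stochastic integral `∫₀¹ f dw`, that is, `W` is a
centred Gaussian process indexed by `L₂(0,1)` whose covariance is the inner product. -/
structure IsGaussianWhiteNoise {Ω : Type*} [MeasurableSpace Ω] (W : Signal → Ω → ℝ)
    (P : Measure Ω) : Prop where
  isGaussianProcess : IsGaussianProcess W P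
  mean_eq_zero : ∀ f : Signal, ∫ ω, W f ω ∂P = 0
  covariance_eq : ∀ f g : Signal, cov[W f, W g; P] = inner ℝ f g

/-- Fourier coefficient `θ_j = ∫₀¹ S φ_j dt`. -/
def fourierCoeff (φ : ℕ → Signal) (S : Signal) (j : ℕ) : ℝ := inner ℝ (φ j) S

/-- The observation `y_{εj} = ∫₀¹ φ_j dY_ε = θ_j + ε ξ_j`, where `dY_ε = S dt + ε dw` and
`ξ_j = ∫₀¹ φ_j dw`. -/
def observation {Ω : Type*} (W : Signal → Ω → ℝ) (φ : ℕ → Signal) (ε : ℝ) (S : Signal)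
    (ω : Ω) (j : ℕ) : ℝ :=
  fourierCoeff φ S j + ε * W (φ j) ω

/-! Coefficients are `κ : ℝ → ℕ → ℝ`, with `κ ε j` standing for `ϰ_{εj}`, `j ≥ 1`. The value at
`j = 0` is never used; a sum over `j ≥ 1` is written as a sum over `j : ℕ` of the `(j+1)`-st term. -/

/-- `ρ_ε² = ∑_{j ≥ 1} ϰ_{εj}²`. -/
def rhoSq (κ : ℝ → ℕ → ℝ) (ε : ℝ) : ℝ := ∑' j : ℕ, κ ε (j + 1) ^ 2

/-- `A_ε = ε⁻⁴ ∑_{j ≥ 1} ϰ_{εj}⁴`. -/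
def A (κ : ℝ → ℕ → ℝ) (ε : ℝ) : ℝ := (ε ^ 4)⁻¹ * ∑' j : ℕ, κ ε (j + 1) ^ 4

/-- `k_ε = sup {k ≥ 1 : ∑_{1 ≤ j < k} ϰ_{εj}² ≤ ρ_ε² / 2}`. -/
def kIndex (κ : ℝ → ℕ → ℝ) (ε : ℝ) : ℕ :=
  sSup {k : ℕ | 1 ≤ k ∧ ∑ j ∈ Finset.Ico 1 k, κ ε j ^ 2 ≤ rhoSq κ ε / 2}

/-- `ϰ_ε² = ϰ_{ε k_ε}²`. -/
def kappaSq (κ : ℝ → ℕ → ℝ) (ε : ℝ) : ℝ := κ ε (kIndex κ ε) ^ 2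

/-- Assumption A1: for each `ε` the sequence `ϰ_{εj}²`, `j ≥ 1`, is nonincreasing. -/
def AssumptionA1 (κ : ℝ → ℕ → ℝ) : Prop :=
  ∀ ε > 0, AntitoneOn (fun j : ℕ => κ ε j ^ 2) (Set.Ici 1)

/-- Assumption A2: `A_ε` is bounded away from zero and infinity. -/
def AssumptionA2 (κ : ℝ → ℕ → ℝ) : Prop :=
  ∃ C₁ C₂ : ℝ, 0 < C₁ ∧ ∀ ε > 0, C₁ < A κ ε ∧ A κ ε < C₂

/-- Assumption A3: `ϰ²_{ε,[(1+δ)k_ε]} < C₁ (1+δ)^{-λ} ϰ_ε²` for some `C₁` and `λ > 1`. -/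
def AssumptionA3 (κ : ℝ → ℕ → ℝ) : Prop :=
  ∃ C₁ l : ℝ, 1 < l ∧ ∀ δ > (0 : ℝ), ∀ ε > 0,
    κ ε ⌊(1 + δ) * (kIndex κ ε : ℝ)⌋₊ ^ 2 < C₁ * (1 + δ) ^ (-l) * kappaSq κ ε

/-- Assumption A4: `ϰ_{ε1}² ≍ ϰ_ε²` as `ε → 0`, and for every `c > 1` there is `C > 0` with
`ϰ²_{ε,[c k_ε]} ≥ C ϰ_ε²` for all `ε > 0`. -/
def AssumptionA4 (κ : ℝ → ℕ → ℝ) : Prop :=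
  (fun ε => κ ε 1 ^ 2) =Θ[𝓝[>] 0] (fun ε => kappaSq κ ε) ∧
  ∀ c > (1 : ℝ), ∃ C > (0 : ℝ), ∀ ε > 0,
    C * kappaSq κ ε ≤ κ ε ⌊c * (kIndex κ ε : ℝ)⌋₊ ^ 2

/-- The statistic `T_ε(y) = ε⁻² ∑_{j ≥ 1} ϰ_{εj}² y_j² - ρ_ε²`. -/
def statistic (κ : ℝ → ℕ → ℝ) (ε : ℝ) (y : ℕ → ℝ) : ℝ :=
  (ε ^ 2)⁻¹ * (∑' j : ℕ, κ ε (j + 1) ^ 2 * y (j + 1) ^ 2) - rhoSq κ ε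

/-- The Neyman-type test with threshold `x`: it rejects (takes the value `1`) when the statistic
standardized by its null variance `2 ε⁴ A_ε`, i.e. `ε⁻² (2 A_ε)^{-1/2} T_ε`, exceeds `x`. -/
def test (κ : ℝ → ℕ → ℝ) (ε x : ℝ) (y : ℕ → ℝ) : ℝ :=
  Set.indicator {z : ℕ → ℝ | x < (ε ^ 2)⁻¹ * (√(2 * A κ ε))⁻¹ * statistic κ ε z} (fun _ => 1) y

/-- Type I error probability `α(L_ε) = E₀ L_ε`. -/
def typeI {Ω : Type*} [MeasurableSpace Ω] (P : Measure Ω) (W : Signal → Ω → ℝ) (φ : ℕ → Signal)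
    (κ : ℝ → ℕ → ℝ) (ε x : ℝ) : ℝ :=
  ∫ ω, test κ ε x (observation W φ ε 0 ω) ∂P

/-- Type II error probability `β(L_ε, S) = E_S (1 - L_ε)`. -/
def typeII {Ω : Type*} [MeasurableSpace Ω] (P : Measure Ω) (W : Signal → Ω → ℝ) (φ : ℕ → Signal)
    (κ : ℝ → ℕ → ℝ) (ε x : ℝ) (S : Signal) : ℝ :=
  ∫ ω, (1 - test κ ε x (observation W φ ε S ω)) ∂P

/-- `D_ε(S) = ε⁻⁴ ∑_{j ≥ 1} ϰ_{εj}² θ_j²`. -/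
def D (φ : ℕ → Signal) (κ : ℝ → ℕ → ℝ) (ε : ℝ) (S : Signal) : ℝ :=
  (ε ^ 4)⁻¹ * ∑' j : ℕ, κ ε (j + 1) ^ 2 * fourierCoeff φ S (j + 1) ^ 2

/-- `B_ε(S) = D_ε(S) / (2 A_ε)^{1/2}`. -/
def B (φ : ℕ → Signal) (κ : ℝ → ℕ → ℝ) (ε : ℝ) (S : Signal) : ℝ :=
  D φ κ ε S / √(2 * A κ ε)

/-- The standard normal distribution function `Φ`. -/
def Phi (x : ℝ) : ℝ := cdf (gaussianReal 0 1) x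

/-- The one-sided order relation `f ≤ C g` for small `ε > 0`, with some constant `C > 0`.
Thus `f = O(g)` is `OrderLE f g`, and `f = Ω(g)` is `OrderLE g f`. -/
def OrderLE (f g : ℝ → ℝ) : Prop := ∃ C > (0 : ℝ), ∀ᶠ ε in 𝓝[>] 0, f ε ≤ C * g ε

end NeymanTest

end

/-!
The statistic, centred at its mean and divided by its standard deviation under the null hypothesis,
is a weighted sum of independent centred noncentral `χ²` variables. By A1, A2 and A4 its largest
weight `β` is of order `k_ε^{-1/2}`, and expanding the logarithm of its Laplace transform shows that
it differs from `z² / 2` by at most `β (2 |z|³ + 4 |z|² B)` on the disc `|z| β ≤ 1 / 4`.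

For the sharp asymptotics, the Laplace transform is compared with the Gaussian one on the vertical
line through the saddle point `Re z = y`. Integrating the difference against the Fourier transform
of a one-sided exponential bounds the difference of the two tails at `y` relative to the Gaussian
tail. For the logarithmic asymptotics, Chernoff's bound from above and exponential tilting from
below suffice. For signals of larger order, Chernoff's bound is applied at a multiple of `r_ε`, and
the type II error has to be shown positive as well, since `Real.log 0 = 0`.
-/

namespace NeymanTest

open scoped FourierTransform Real
open Complex (I)

section VerticalLine

variable {Ω Ω' : Type*} [MeasurableSpace Ω] [MeasurableSpace Ω'] {P : Measure Ω}
  {P' : Measure Ω'} {X : Ω → ℝ} {X' : Ω' → ℝ}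

/-- The moment generating function on the vertical line `Re z = t`. The variable `w` is the
frequency in Mathlib's normalization of the Fourier transform, so that `Im z = 2πw`. -/
noncomputable def verticalMGF (X : Ω → ℝ) (P : Measure Ω) (t w : ℝ) : ℂ :=
  complexMGF X P (t + (2 * π * w : ℝ) * I)

lemma norm_verticalMGF_le_mgf (X : Ω → ℝ) (P : Measure Ω) (t w : ℝ) :
    ‖verticalMGF X P t w‖ ≤ mgf X P t := by
  simpa [verticalMGF] using norm_complexMGF_le_mgf (X := X) (μ := P) (z := t + (2 * π * w : ℝ) * I)

lemma aestronglyMeasurable_verticalMGF [SFinite P] (hX : AEMeasurable X P) (t : ℝ) :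
    AEStronglyMeasurable (verticalMGF X P t) := by
  have : AEMeasurable (fun p : ℝ × Ω => X p.2) (volume.prod P) := hX.comp_snd
  have hexp : AEStronglyMeasurable (fun p : ℝ × Ω =>
      Complex.exp ((t + (2 * π * p.1 : ℝ) * I) * X p.2)) (volume.prod P) :=
    AEMeasurable.aestronglyMeasurable (by fun_prop)
  exact hexp.integral_prod_right'

lemma norm_cexp_neg_ofReal_mul_I (x : ℝ) : ‖Complex.exp (-(x : ℂ) * I)‖ = 1 := by
  rw [← Complex.ofReal_neg, Complex.norm_exp_ofReal_mul_I]

lemma integrable_mul_verticalMGF [SFinite P] (hX : AEMeasurable X P) {F : ℝ → ℂ}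
    (hF : Integrable F) (t y : ℝ) :
    Integrable fun w => F w * (Complex.exp (-(2 * π * w * y : ℝ) * I) * verticalMGF X P t w) := by
  refine hF.mul_bdd (c := mgf X P t) ?_ (ae_of_all _ fun w => ?_)
  · exact AEStronglyMeasurable.mul (Measurable.aestronglyMeasurable (by fun_prop))
      (aestronglyMeasurable_verticalMGF hX t)
  · rw [norm_mul, norm_cexp_neg_ofReal_mul_I, one_mul]
    exact norm_verticalMGF_le_mgf X P t w

lemma integral_exp_mul_comp_sub_eq [SFinite P] (hX : AEMeasurable X P) {f : ℝ → ℂ}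
    (hf_cont : Continuous f) (hf : Integrable f) (hFf : Integrable (𝓕 f)) {t : ℝ}
    (hexp : Integrable (fun ω => Real.exp (t * X ω)) P) (y : ℝ) :
    ∫ ω, (Real.exp (t * X ω) : ℂ) * f (X ω - y) ∂P =
      ∫ w, 𝓕 f w * (Complex.exp (-(2 * π * w * y : ℝ) * I) * verticalMGF X P t w) := by
  have inversion (v : ℝ) : f v = ∫ w, Complex.exp ((2 * π * w * v : ℝ) * I) * 𝓕 f w := by
    rw [← congrFun (hf_cont.fourierInv_fourier_eq hf hFf) v, Real.fourierInv_eq']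
    refine integral_congr_ae (ae_of_all _ fun w => ?_)
    simp [mul_comm, mul_assoc, mul_left_comm]
  have hprod : Integrable (Function.uncurry fun (ω : Ω) (w : ℝ) => (Real.exp (t * X ω) : ℂ) *
      (Complex.exp ((2 * π * w * (X ω - y) : ℝ) * I) * 𝓕 f w)) (P.prod volume) := by
    have : AEMeasurable (fun p : Ω × ℝ => X p.1) (P.prod volume) := hX.comp_fst
    refine (hexp.mul_prod hFf.norm).mono' ?_ (ae_of_all _ fun p => ?_)
    · simp only [Function.uncurry_def]
      exact (AEMeasurable.aestronglyMeasurable (by fun_prop)).mul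
        ((AEMeasurable.aestronglyMeasurable (by fun_prop)).mul hFf.aestronglyMeasurable.comp_snd)
    · simp only [Function.uncurry_def, norm_mul, Complex.norm_exp_ofReal_mul_I, one_mul,
        Complex.norm_real, Real.norm_of_nonneg (Real.exp_pos _).le, le_refl]
  simp_rw [inversion (X _ - y), ← integral_const_mul]
  rw [integral_integral_swap hprod]
  refine integral_congr_ae (ae_of_all _ fun w => ?_)
  simp only [verticalMGF, complexMGF, ← integral_const_mul]
  refine integral_congr_ae (ae_of_all _ fun ω => ?_)
  simp only
  rw [Complex.ofReal_exp, ← mul_assoc, ← Complex.exp_add, ← Complex.exp_add, mul_comm]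
  congr 2
  push_cast
  ring

lemma norm_integral_exp_mul_comp_sub_sub_le [SFinite P] [SFinite P'] (hX : AEMeasurable X P)
    (hX' : AEMeasurable X' P') {f : ℝ → ℂ} (hf_cont : Continuous f) (hf : Integrable f)
    (hFf : Integrable (𝓕 f)) {C : ℝ} (hC : ∀ w, ‖𝓕 f w‖ ≤ C) {t : ℝ}
    (hexp : Integrable (fun ω => Real.exp (t * X ω)) P)
    (hexp' : Integrable (fun ω => Real.exp (t * X' ω)) P')
    (hdiff : Integrable fun w => verticalMGF X P t w - verticalMGF X' P' t w) (y : ℝ) :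
    ‖∫ ω, (Real.exp (t * X ω) : ℂ) * f (X ω - y) ∂P -
        ∫ ω, (Real.exp (t * X' ω) : ℂ) * f (X' ω - y) ∂P'‖ ≤
      C * ∫ w, ‖verticalMGF X P t w - verticalMGF X' P' t w‖ := by
  rw [integral_exp_mul_comp_sub_eq hX hf_cont hf hFf hexp y,
    integral_exp_mul_comp_sub_eq hX' hf_cont hf hFf hexp' y,
    ← integral_sub (integrable_mul_verticalMGF hX hFf t y)
      (integrable_mul_verticalMGF hX' hFf t y), ← integral_const_mul]
  refine norm_integral_le_of_norm_le (hdiff.norm.const_mul _) (ae_of_all _ fun w => ?_)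
  rw [← mul_sub, ← mul_sub, norm_mul, norm_mul, norm_cexp_neg_ofReal_mul_I, one_mul]
  gcongr
  exact hC w

end VerticalLine

section ExpKernel

/-- A continuous approximation of the one-sided exponential `v ↦ e^{-tv} 1{v > 0}`, which it
approaches as `m → ∞`. Unlike the one-sided exponential, it has an integrable Fourier transform. -/
noncomputable def expKernel (t m v : ℝ) : ℝ :=
  Real.exp (-t * max v 0) - Real.exp (-(t + m) * max v 0)

variable {t m : ℝ}

lemma continuous_expKernel (t m : ℝ) : Continuous (expKernel t m) := by
  unfold expKernel; fun_prop

lemma expKernel_nonneg (hm : 0 ≤ m) (v : ℝ) : 0 ≤ expKernel t m v := by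
  rw [expKernel, sub_nonneg, Real.exp_le_exp]
  nlinarith [le_max_right v 0]

lemma expKernel_le_one (ht : 0 ≤ t) (v : ℝ) : expKernel t m v ≤ 1 := by
  have : Real.exp (-t * max v 0) ≤ 1 := by
    rw [Real.exp_le_one_iff]; nlinarith [le_max_right v 0]
  rw [expKernel]
  linarith [Real.exp_pos (-(t + m) * max v 0)]

lemma tendsto_expKernel (t v : ℝ) :
    Tendsto (fun m : ℕ => expKernel t m v) atTop
      (𝓝 ((Set.Ioi 0).indicator (fun v => Real.exp (-t * v)) v)) := by
  rcases le_or_gt v 0 with hv | hv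
  · rw [Set.indicator_of_notMem (Set.notMem_Ioi.2 hv)]
    simp [expKernel, max_eq_right hv]
  · have hlim : Tendsto (fun m : ℕ => Real.exp (-(t + m) * v)) atTop (𝓝 0) :=
      Real.tendsto_exp_atBot.comp ((tendsto_neg_atTop_atBot.comp
        (tendsto_atTop_add_const_left _ _ tendsto_natCast_atTop_atTop)).atBot_mul_const hv)
    rw [Set.indicator_of_mem (Set.mem_Ioi.2 hv)]
    simpa only [expKernel, max_eq_left hv.le, sub_zero] using hlim.const_sub (Real.exp (-t * v))

lemma ofReal_expKernel_eq_indicator (t m : ℝ) :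
    (fun v => (expKernel t m v : ℂ)) = Set.indicator (Set.Ioi 0)
      (fun v : ℝ => Complex.exp ((-t : ℂ) * v) - Complex.exp ((-(t + m) : ℂ) * v)) := by
  ext v
  rcases le_or_gt v 0 with hv | hv
  · rw [Set.indicator_of_notMem (Set.notMem_Ioi.2 hv)]
    simp [expKernel, max_eq_right hv]
  · rw [Set.indicator_of_mem (Set.mem_Ioi.2 hv), expKernel, max_eq_left hv.le]
    push_cast
    rfl

lemma integrable_ofReal_expKernel (ht : 0 < t) (hm : 0 ≤ m) :
    Integrable (fun v => (expKernel t m v : ℂ)) := by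
  rw [ofReal_expKernel_eq_indicator, integrable_indicator_iff measurableSet_Ioi]
  refine (integrableOn_exp_mul_complex_Ioi ?_ 0).sub (integrableOn_exp_mul_complex_Ioi ?_ 0)
  · simpa using ht
  · simp only [Complex.neg_re, Complex.add_re, Complex.ofReal_re]; linarith

lemma fourier_expKernel (ht : 0 < t) (hm : 0 ≤ m) (w : ℝ) :
    𝓕 (fun v => (expKernel t m v : ℂ)) w =
      m / ((t + (2 * π * w : ℝ) * I) * ((t + m : ℝ) + (2 * π * w : ℝ) * I)) := by
  set a : ℂ := t + (2 * π * w : ℝ) * I with ha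
  set b : ℂ := (t + m : ℝ) + (2 * π * w : ℝ) * I with hb
  have ha_re : (-a).re < 0 := by simpa [ha] using ht
  have hb_re : (-b).re < 0 := by
    simp only [hb, Complex.neg_re, Complex.add_re, Complex.ofReal_re, Complex.re_ofReal_mul,
      Complex.I_re, mul_zero]
    linarith
  have ha0 : a ≠ 0 := fun h => by simp [h] at ha_re
  have hb0 : b ≠ 0 := fun h => by simp [h] at hb_re
  have hintegrand (v : ℝ) : Complex.exp (↑(-2 * π * v * w) * I) •
      (fun v => (expKernel t m v : ℂ)) v = Set.indicator (Set.Ioi 0)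
        (fun v : ℝ => Complex.exp (-a * v) - Complex.exp (-b * v)) v := by
    rw [ofReal_expKernel_eq_indicator]
    by_cases hv : v ∈ Set.Ioi (0 : ℝ)
    · simp only [Set.indicator_of_mem hv, smul_eq_mul, mul_sub, ← Complex.exp_add, ha, hb]
      congr 2 <;> push_cast <;> ring
    · simp only [Set.indicator_of_notMem hv, smul_zero]
  rw [Real.fourier_real_eq_integral_exp_smul]
  simp_rw [hintegrand]
  rw [integral_indicator measurableSet_Ioi, integral_sub
    (integrableOn_exp_mul_complex_Ioi ha_re 0) (integrableOn_exp_mul_complex_Ioi hb_re 0),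
    integral_exp_mul_complex_Ioi ha_re, integral_exp_mul_complex_Ioi hb_re]
  have hba : b - a = m := by rw [ha, hb]; push_cast; ring
  simp only [Complex.ofReal_zero, mul_zero, Complex.exp_zero, neg_div_neg_eq]
  rw [div_sub_div _ _ ha0 hb0, one_mul, mul_one, hba]

lemma norm_fourier_expKernel (ht : 0 < t) (hm : 0 ≤ m) (w : ℝ) :
    ‖𝓕 (fun v => (expKernel t m v : ℂ)) w‖ =
      m / (√(t ^ 2 + (2 * π * w) ^ 2) * √((t + m) ^ 2 + (2 * π * w) ^ 2)) := by
  rw [fourier_expKernel ht hm, norm_div, norm_mul, Complex.norm_real, Real.norm_of_nonneg hm,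
    Complex.norm_add_mul_I, Complex.norm_add_mul_I]

lemma norm_fourier_expKernel_le_inv (ht : 0 < t) (hm : 0 ≤ m) (w : ℝ) :
    ‖𝓕 (fun v => (expKernel t m v : ℂ)) w‖ ≤ t⁻¹ := by
  have ht_le : t ≤ √(t ^ 2 + (2 * π * w) ^ 2) := Real.le_sqrt_of_sq_le (by nlinarith)
  have hm_le : m ≤ √((t + m) ^ 2 + (2 * π * w) ^ 2) := Real.le_sqrt_of_sq_le (by nlinarith)
  have hpos : 0 < √((t + m) ^ 2 + (2 * π * w) ^ 2) := Real.sqrt_pos.2 (by positivity)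
  rw [norm_fourier_expKernel ht hm, div_le_iff₀ (mul_pos (ht.trans_le ht_le) hpos),
    inv_mul_eq_div, le_div_iff₀ ht]
  nlinarith

lemma norm_fourier_expKernel_le_mul_inv (ht : 0 < t) (hm : 0 ≤ m) (w : ℝ) :
    ‖𝓕 (fun v => (expKernel t m v : ℂ)) w‖ ≤ m * (t ^ 2 + (2 * π * w) ^ 2)⁻¹ := by
  have hle : √(t ^ 2 + (2 * π * w) ^ 2) ≤ √((t + m) ^ 2 + (2 * π * w) ^ 2) := by gcongr; linarith
  rw [norm_fourier_expKernel ht hm, ← div_eq_mul_inv]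
  gcongr
  exact (Real.mul_self_sqrt (by positivity)).symm.trans_le (by gcongr)

lemma integrable_fourier_expKernel (ht : 0 < t) (hm : 0 ≤ m) :
    Integrable (𝓕 (fun v => (expKernel t m v : ℂ))) := by
  have hbound : Integrable fun w : ℝ => m * (t ^ 2)⁻¹ * (1 + (2 * π / t * w) ^ 2)⁻¹ :=
    (integrable_inv_one_add_sq.comp_mul_left' (by positivity)).const_mul _
  have hmeas : AEStronglyMeasurable (𝓕 (fun v => (expKernel t m v : ℂ))) := by
    rw [funext fun w => fourier_expKernel ht hm w]
    exact Measurable.aestronglyMeasurable (by fun_prop)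
  refine hbound.mono' hmeas (ae_of_all _ fun w => ?_)
  refine (norm_fourier_expKernel_le_mul_inv ht hm w).trans_eq ?_
  field_simp

end ExpKernel

section TailComparison

variable {Ω Ω' : Type*} [MeasurableSpace Ω] [MeasurableSpace Ω'] {P : Measure Ω}
  {P' : Measure Ω'} {X : Ω → ℝ} {X' : Ω' → ℝ} {t : ℝ}

lemma tendsto_integral_exp_mul_expKernel (hX : AEMeasurable X P) (ht : 0 ≤ t)
    (hexp : Integrable (fun ω => Real.exp (t * X ω)) P) (y : ℝ) :
    Tendsto (fun m : ℕ => ∫ ω, Real.exp (t * X ω) * expKernel t m (X ω - y) ∂P) atTop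
      (𝓝 (Real.exp (t * y) * P.real {ω | y < X ω})) := by
  have hmeas : NullMeasurableSet {ω | y < X ω} P := nullMeasurableSet_lt aemeasurable_const hX
  have hlim : Real.exp (t * y) * P.real {ω | y < X ω} =
      ∫ ω, Set.indicator {ω | y < X ω} (fun _ => Real.exp (t * y)) ω ∂P := by
    rw [integral_indicator₀ hmeas, setIntegral_const, smul_eq_mul, mul_comm]
  rw [hlim]
  refine tendsto_integral_of_dominated_convergence (fun ω => Real.exp (t * X ω)) (fun m => ?_) hexp
    (fun m => ae_of_all _ fun ω => ?_) (ae_of_all _ fun ω => ?_)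
  · have := (continuous_expKernel t m).measurable
    exact AEMeasurable.aestronglyMeasurable (by fun_prop)
  · rw [norm_mul, Real.norm_of_nonneg (Real.exp_pos _).le,
      Real.norm_of_nonneg (expKernel_nonneg (Nat.cast_nonneg m) _)]
    exact mul_le_of_le_one_right (Real.exp_pos _).le (expKernel_le_one ht _)
  · convert (tendsto_expKernel t (X ω - y)).const_mul (Real.exp (t * X ω)) using 2
    by_cases hω : y < X ω
    · rw [Set.indicator_of_mem (show ω ∈ {ω | y < X ω} from hω),
        Set.indicator_of_mem (Set.mem_Ioi.2 (sub_pos.2 hω)), ← Real.exp_add]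
      ring_nf
    · rw [Set.indicator_of_notMem (show ω ∉ {ω | y < X ω} from hω),
        Set.indicator_of_notMem (by simpa using hω), mul_zero]

theorem abs_measureReal_lt_sub_le [SFinite P] [SFinite P'] (hX : AEMeasurable X P)
    (hX' : AEMeasurable X' P') (ht : 0 < t) (hexp : Integrable (fun ω => Real.exp (t * X ω)) P)
    (hexp' : Integrable (fun ω => Real.exp (t * X' ω)) P')
    (hdiff : Integrable fun w => verticalMGF X P t w - verticalMGF X' P' t w) (y : ℝ) :
    t * Real.exp (t * y) * |P.real {ω | y < X ω} - P'.real {ω | y < X' ω}| ≤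
      ∫ w, ‖verticalMGF X P t w - verticalMGF X' P' t w‖ := by
  have hbound (m : ℕ) : |(∫ ω, Real.exp (t * X ω) * expKernel t m (X ω - y) ∂P) -
      ∫ ω, Real.exp (t * X' ω) * expKernel t m (X' ω - y) ∂P'| ≤
        t⁻¹ * ∫ w, ‖verticalMGF X P t w - verticalMGF X' P' t w‖ := by
    have hm : (0 : ℝ) ≤ m := Nat.cast_nonneg m
    rw [← Real.norm_eq_abs, ← Complex.norm_real, Complex.ofReal_sub, ← integral_complex_ofReal,
      ← integral_complex_ofReal]
    simp only [Complex.ofReal_mul]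
    exact norm_integral_exp_mul_comp_sub_sub_le hX hX'
      (Complex.continuous_ofReal.comp (continuous_expKernel t m))
      (integrable_ofReal_expKernel ht hm) (integrable_fourier_expKernel ht hm)
      (norm_fourier_expKernel_le_inv ht hm) hexp hexp' hdiff y
  have hlim := le_of_tendsto' ((tendsto_integral_exp_mul_expKernel hX ht.le hexp y).sub
    (tendsto_integral_exp_mul_expKernel hX' ht.le hexp' y)).abs hbound
  rw [← mul_sub, abs_mul, abs_of_pos (Real.exp_pos _), inv_mul_eq_div, le_div_iff₀ ht] at hlim
  linarith

lemma tendsto_measureReal_lt [IsFiniteMeasure P] (hX : AEMeasurable X P) {u : ℕ → ℝ} {y : ℝ}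
    (hu_mono : Monotone u) (hu_lt : ∀ n, u n < y) (hu : Tendsto u atTop (𝓝 y)) :
    Tendsto (fun n => P.real {ω | u n < X ω}) atTop (𝓝 (P.real {ω | y ≤ X ω})) := by
  have hinter : {ω | y ≤ X ω} = ⋂ n, {ω | u n < X ω} := by
    ext ω
    simp only [Set.mem_ofPred_eq, Set.mem_iInter]
    exact ⟨fun h n => (hu_lt n).trans_le h, fun h => le_of_tendsto' hu fun n => (h n).le⟩
  rw [hinter]
  refine (ENNReal.tendsto_toReal (measure_ne_top _ _)).comp (tendsto_measure_iInter_atTop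
    (fun n => nullMeasurableSet_lt aemeasurable_const hX) ?_ ⟨0, measure_ne_top _ _⟩)
  exact fun i j hij ω hω => (hu_mono hij).trans_lt hω

theorem abs_measureReal_le_sub_le [IsFiniteMeasure P] [IsFiniteMeasure P'] (hX : AEMeasurable X P)
    (hX' : AEMeasurable X' P') (ht : 0 < t) (hexp : Integrable (fun ω => Real.exp (t * X ω)) P)
    (hexp' : Integrable (fun ω => Real.exp (t * X' ω)) P')
    (hdiff : Integrable fun w => verticalMGF X P t w - verticalMGF X' P' t w) (y : ℝ) :
    t * Real.exp (t * y) * |P.real {ω | y ≤ X ω} - P'.real {ω | y ≤ X' ω}| ≤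
      ∫ w, ‖verticalMGF X P t w - verticalMGF X' P' t w‖ := by
  obtain ⟨u, hu_mono, hu_lt, hu⟩ := exists_seq_strictMono_tendsto y
  have hfactor : Tendsto (fun n => t * Real.exp (t * u n)) atTop (𝓝 (t * Real.exp (t * y))) :=
    ((Real.continuous_exp.tendsto _).comp (hu.const_mul t)).const_mul t
  exact le_of_tendsto' (hfactor.mul ((tendsto_measureReal_lt hX hu_mono.monotone hu_lt hu).sub
    (tendsto_measureReal_lt hX' hu_mono.monotone hu_lt hu)).abs)
    fun n => abs_measureReal_lt_sub_le hX hX' ht hexp hexp' hdiff (u n)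

end TailComparison

section CumulantTerm

variable {b d t u : ℝ} {z : ℂ}

/-- The logarithm of the Laplace transform of `b (ξ² - 1) + 2 b τ ξ`, where `ξ` is standard normal
and `d = b τ²`: one coordinate of the standardized statistic, centred at its mean. -/
noncomputable def cumulantTerm (b d : ℝ) (z : ℂ) : ℂ :=
  -(1 / 2) * Complex.log (1 - 2 * z * b) - z * b + 2 * z ^ 2 * b * d / (1 - 2 * z * b)

lemma re_one_sub_two_mul (z : ℂ) (b : ℝ) : (1 - 2 * z * b).re = 1 - 2 * (z.re * b) := by
  simp only [Complex.sub_re, Complex.one_re, Complex.mul_re, Complex.re_ofNat, Complex.im_ofNat,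
    Complex.ofReal_re, Complex.ofReal_im, zero_mul, mul_zero, sub_zero, mul_assoc]

lemma half_le_re_one_sub_two_mul (hz : z.re * b ≤ 1 / 4) : 1 / 2 ≤ (1 - 2 * z * b).re := by
  rw [re_one_sub_two_mul]; linarith

lemma norm_noncentral_term_le (hb : 0 ≤ b) (hd : 0 ≤ d) (hz : z.re * b ≤ 1 / 4) :
    ‖2 * z ^ 2 * b * d / (1 - 2 * z * b)‖ ≤ 4 * ‖z‖ ^ 2 * b * d := by
  have hden : 1 / 2 ≤ ‖1 - 2 * z * b‖ :=
    (half_le_re_one_sub_two_mul hz).trans (Complex.re_le_norm _)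
  have hnum : 0 ≤ 2 * ‖z‖ ^ 2 * b * d := by positivity
  rw [norm_div, div_le_iff₀ (by linarith)]
  simp only [norm_mul, norm_pow, Complex.norm_real, Real.norm_of_nonneg hb, Real.norm_of_nonneg hd,
    Complex.norm_ofNat]
  nlinarith

lemma norm_neg_half_log_one_sub_sub_le {w : ℂ} (hw : ‖w‖ ≤ 1 / 4) :
    ‖-(1 / 2) * Complex.log (1 - 2 * w) - w - w ^ 2‖ ≤ 4 * ‖w‖ ^ 3 := by
  have hnorm : ‖(-(2 * w) : ℂ)‖ = 2 * ‖w‖ := by simp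
  have htaylor : -(1 / 2) * Complex.log (1 - 2 * w) - w - w ^ 2 =
      -(1 / 2) * (Complex.log (1 + -(2 * w)) - Complex.logTaylor (2 + 1) (-(2 * w))) := by
    rw [← sub_eq_add_neg]
    simp [Complex.logTaylor_succ, Complex.logTaylor_zero]
    ring
  have hinv : (1 - 2 * ‖w‖)⁻¹ ≤ 2 := by
    rw [inv_le_comm₀ (by linarith) (by norm_num)]; linarith
  calc ‖-(1 / 2) * Complex.log (1 - 2 * w) - w - w ^ 2‖
      = 1 / 2 * ‖Complex.log (1 + -(2 * w)) - Complex.logTaylor (2 + 1) (-(2 * w))‖ := by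
        rw [htaylor, norm_mul]; norm_num
    _ ≤ 1 / 2 * ((2 * ‖w‖) ^ (2 + 1) * (1 - 2 * ‖w‖)⁻¹ / ((2 : ℕ) + 1)) := by
        gcongr
        simpa only [hnorm] using
          Complex.norm_log_sub_logTaylor_le 2 (z := -(2 * w)) (by rw [hnorm]; linarith)
    _ ≤ 1 / 2 * ((2 * ‖w‖) ^ (2 + 1) * 2 / ((2 : ℕ) + 1)) := by gcongr
    _ ≤ 4 * ‖w‖ ^ 3 := by
        have : 0 ≤ ‖w‖ ^ 3 := by positivity
        push_cast
        linarith

lemma norm_cumulantTerm_sub_le (hb : 0 ≤ b) (hd : 0 ≤ d) (hz : ‖z‖ * b ≤ 1 / 4) :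
    ‖cumulantTerm b d z - z ^ 2 * (b ^ 2 : ℝ)‖ ≤ 4 * ‖z‖ ^ 3 * b ^ 3 + 4 * ‖z‖ ^ 2 * b * d := by
  have hnorm : ‖z * b‖ = ‖z‖ * b := by rw [norm_mul, Complex.norm_real, Real.norm_of_nonneg hb]
  have hre : z.re * b ≤ 1 / 4 := (mul_le_mul_of_nonneg_right (Complex.re_le_norm z) hb).trans hz
  have hcentral := norm_neg_half_log_one_sub_sub_le (w := z * b) (by rwa [hnorm])
  have hsplit : cumulantTerm b d z - z ^ 2 * (b ^ 2 : ℝ) =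
      (-(1 / 2) * Complex.log (1 - 2 * (z * b)) - z * b - (z * b) ^ 2) +
        2 * z ^ 2 * b * d / (1 - 2 * z * b) := by
    rw [cumulantTerm, ← mul_assoc]; push_cast; ring
  rw [hsplit]
  exact (norm_add_le _ _).trans (add_le_add
    (hcentral.trans_eq (by rw [hnorm]; ring)) (norm_noncentral_term_le hb hd hre))

lemma normSq_one_sub_two_mul (t u b : ℝ) :
    Complex.normSq (1 - 2 * (t + u * I) * b) = (1 - 2 * t * b) ^ 2 + 4 * u ^ 2 * b ^ 2 := by
  rw [Complex.normSq_apply]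
  simp
  ring

lemma re_noncentral_term_le (hb : 0 ≤ b) (hd : 0 ≤ d) (hp : 0 < 1 - 2 * t * b) :
    (2 * (t + u * I) ^ 2 * b * d / (1 - 2 * (t + u * I) * b)).re ≤
      2 * t ^ 2 * b * d / (1 - 2 * t * b) := by
  set p := 1 - 2 * t * b with hpdef
  have hq : 0 < p ^ 2 + 4 * u ^ 2 * b ^ 2 := by positivity
  have hre : (2 * (t + u * I) ^ 2 * b * d / (1 - 2 * (t + u * I) * b)).re =
      2 * b * d * ((t ^ 2 - u ^ 2) * p - 4 * t * u ^ 2 * b) / (p ^ 2 + 4 * u ^ 2 * b ^ 2) := by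
    rw [Complex.div_re, normSq_one_sub_two_mul, ← hpdef, ← add_div]
    congr 1
    simp [pow_two, hpdef]
    ring
  have hgap : t ^ 2 * (p ^ 2 + 4 * u ^ 2 * b ^ 2) - ((t ^ 2 - u ^ 2) * p - 4 * t * u ^ 2 * b) * p =
      u ^ 2 * (p + 2 * t * b) ^ 2 := by ring
  rw [hre, div_le_div_iff₀ hq hp]
  calc 2 * b * d * ((t ^ 2 - u ^ 2) * p - 4 * t * u ^ 2 * b) * p
      = 2 * b * d * (((t ^ 2 - u ^ 2) * p - 4 * t * u ^ 2 * b) * p) := by ring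
    _ ≤ 2 * b * d * (t ^ 2 * (p ^ 2 + 4 * u ^ 2 * b ^ 2)) :=
        mul_le_mul_of_nonneg_left (sub_nonneg.1 (by rw [hgap]; positivity)) (by positivity)
    _ = 2 * t ^ 2 * b * d * (p ^ 2 + 4 * u ^ 2 * b ^ 2) := by ring

lemma mul_log_one_add_le_log_one_add_mul {s c : ℝ} (hs : 0 ≤ s) (hc : 0 ≤ c) (hc1 : c ≤ 1) :
    c * Real.log (1 + s) ≤ Real.log (1 + c * s) := by
  rw [← Real.log_rpow (by linarith)]
  exact Real.log_le_log (Real.rpow_pos_of_pos (by linarith) _)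
    (rpow_one_add_le_one_add_mul_self (by linarith) hc hc1)

lemma log_norm_one_sub_two_mul_ge (hb : 0 ≤ b) (hb4 : b ≤ 1 / 4) (ht : |t| * b ≤ 1 / 4) :
    Real.log (1 - 2 * t * b) + 8 * b ^ 2 * Real.log (1 + u ^ 2 / 16) ≤
      Real.log ‖1 - 2 * (t + u * I) * b‖ := by
  obtain ⟨hl, hu⟩ := abs_le.1 (by rwa [abs_mul, abs_of_nonneg hb] : |t * b| ≤ 1 / 4)
  set p := 1 - 2 * t * b with hpdef
  have hp : 0 < p := by rw [hpdef]; linarith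
  have hp_le : p ^ 2 ≤ 4 := by
    have : p ≤ 2 := by rw [hpdef]; linarith
    nlinarith
  have hlog_norm : Real.log ‖1 - 2 * (t + u * I) * b‖ =
      Real.log (p ^ 2 + 4 * u ^ 2 * b ^ 2) / 2 := by
    rw [Complex.norm_def, Real.log_sqrt (Complex.normSq_nonneg _), normSq_one_sub_two_mul]
  have hconcave := mul_log_one_add_le_log_one_add_mul (s := u ^ 2 / 16) (c := 16 * b ^ 2)
    (by positivity) (by positivity) (by nlinarith)
  have hproduct : 2 * Real.log p + Real.log (1 + 16 * b ^ 2 * (u ^ 2 / 16)) ≤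
      Real.log (p ^ 2 + 4 * u ^ 2 * b ^ 2) := by
    rw [← Nat.cast_ofNat, ← Real.log_pow, ← Real.log_mul (by positivity) (by positivity)]
    refine Real.log_le_log (by positivity) ?_
    have : 0 ≤ b ^ 2 * u ^ 2 := by positivity
    nlinarith
  rw [hlog_norm]
  linarith

lemma re_cumulantTerm (b d : ℝ) (z : ℂ) :
    (cumulantTerm b d z).re = -(1 / 2) * Real.log ‖1 - 2 * z * b‖ - z.re * b +
      (2 * z ^ 2 * b * d / (1 - 2 * z * b)).re := by
  have hhalf : (-(1 / 2) : ℂ) = ((-(1 / 2) : ℝ) : ℂ) := by push_cast; rfl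
  rw [cumulantTerm, Complex.add_re, Complex.sub_re, hhalf, Complex.re_ofReal_mul, Complex.log_re,
    Complex.re_mul_ofReal]

lemma re_cumulantTerm_ofReal (ht : 2 * t * b ≤ 1) :
    (cumulantTerm b d t).re = -(1 / 2) * Real.log (1 - 2 * t * b) - t * b +
      2 * t ^ 2 * b * d / (1 - 2 * t * b) := by
  have hden : (1 - 2 * t * b : ℂ) = (1 - 2 * t * b : ℝ) := by push_cast; rfl
  have hquot : (2 * (t : ℂ) ^ 2 * b * d / (1 - 2 * t * b)).re =
      2 * t ^ 2 * b * d / (1 - 2 * t * b) := by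
    rw [← Complex.ofReal_re (2 * t ^ 2 * b * d / (1 - 2 * t * b))]
    push_cast
    rfl
  rw [re_cumulantTerm, hquot, hden, Complex.norm_real, Real.norm_of_nonneg (by linarith),
    Complex.ofReal_re]

lemma re_cumulantTerm_le (hb : 0 ≤ b) (hb4 : b ≤ 1 / 4) (hd : 0 ≤ d) (ht : |t| * b ≤ 1 / 4) :
    (cumulantTerm b d (t + u * I)).re ≤
      (cumulantTerm b d t).re - 4 * Real.log (1 + u ^ 2 / 16) * b ^ 2 := by
  have htb : t * b ≤ 1 / 4 := (mul_le_mul_of_nonneg_right (le_abs_self t) hb).trans ht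
  have hlog := log_norm_one_sub_two_mul_ge (u := u) hb hb4 ht
  have hnoncentral := re_noncentral_term_le (u := u) hb hd (t := t) (by linarith)
  have hre : (t + u * I : ℂ).re = t := by simp
  rw [re_cumulantTerm, re_cumulantTerm_ofReal (by linarith), hre]
  linarith

end CumulantTerm

section Cumulant

/-- Weights `b` of a Gaussian quadratic form, bounded by `β` and normalized to total squared weight
`1/2` (so that the central form has variance one), together with its noncentralities `d`. -/
structure IsWeightSystem (b d : ℕ → ℝ) (β : ℝ) : Prop where
  nonneg : ∀ j, 0 ≤ b j
  le_bound : ∀ j, b j ≤ β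
  nonneg_noncentrality : ∀ j, 0 ≤ d j
  summable : Summable b
  summable_noncentrality : Summable d
  hasSum_sq : HasSum (fun j => b j ^ 2) (1 / 2)

/-- The logarithm of the Laplace transform of the centred quadratic form with weights `b` and
noncentralities `d`. -/
noncomputable def cumulant (b d : ℕ → ℝ) (z : ℂ) : ℂ := ∑' j, cumulantTerm (b j) (d j) z

variable {b d : ℕ → ℝ} {β c t : ℝ} {z : ℂ}

namespace IsWeightSystem

lemma bound_nonneg (h : IsWeightSystem b d β) : 0 ≤ β :=
  (h.nonneg 0).trans (h.le_bound 0)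

lemma mul_weight_le (h : IsWeightSystem b d β) (hc : c * β ≤ 1 / 4) (j : ℕ) : c * b j ≤ 1 / 4 := by
  rcases le_total 0 c with hc0 | hc0
  · exact (mul_le_mul_of_nonneg_left (h.le_bound j) hc0).trans hc
  · exact (mul_nonpos_of_nonpos_of_nonneg hc0 (h.nonneg j)).trans (by norm_num)

lemma norm_noncentral_term_le (h : IsWeightSystem b d β) (hz : z.re * β ≤ 1 / 4) (j : ℕ) :
    ‖2 * z ^ 2 * b j * d j / (1 - 2 * z * b j)‖ ≤ 4 * ‖z‖ ^ 2 * β * d j := by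
  have hd := h.nonneg_noncentrality j
  refine (NeymanTest.norm_noncentral_term_le (h.nonneg j) hd (h.mul_weight_le hz j)).trans ?_
  gcongr
  exact h.le_bound j

lemma summable_cumulantTerm (h : IsWeightSystem b d β) (hz : z.re * β ≤ 1 / 4) :
    Summable fun j => cumulantTerm (b j) (d j) z := by
  have hb : Summable fun j => (b j : ℂ) := Complex.summable_ofReal.2 h.summable
  have hlog : Summable fun j => Complex.log (1 + -(2 * z * b j)) :=
    Complex.summable_log_one_add_of_summable (hb.mul_left (2 * z)).neg
  simp only [← sub_eq_add_neg] at hlog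
  exact ((hlog.mul_left _).sub (hb.mul_left z)).add (Summable.of_norm_bounded
    (h.summable_noncentrality.mul_left (4 * ‖z‖ ^ 2 * β)) (h.norm_noncentral_term_le hz))

theorem norm_cumulant_sub_le (h : IsWeightSystem b d β) (hz : ‖z‖ * β ≤ 1 / 4) :
    ‖cumulant b d z - z ^ 2 / 2‖ ≤ β * (2 * ‖z‖ ^ 3 + 4 * ‖z‖ ^ 2 * ∑' j, d j) := by
  have hz_re : z.re * β ≤ 1 / 4 :=
    (mul_le_mul_of_nonneg_right (Complex.re_le_norm z) h.bound_nonneg).trans hz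
  have hdiff : HasSum (fun j => cumulantTerm (b j) (d j) z - z ^ 2 * (b j ^ 2 : ℝ))
      (cumulant b d z - z ^ 2 * (1 / 2 : ℝ)) :=
    (h.summable_cumulantTerm hz_re).hasSum.sub ((Complex.hasSum_ofReal.2 h.hasSum_sq).mul_left _)
  have hbound : HasSum (fun j => 4 * ‖z‖ ^ 3 * β * b j ^ 2 + 4 * ‖z‖ ^ 2 * β * d j)
      (4 * ‖z‖ ^ 3 * β * (1 / 2) + 4 * ‖z‖ ^ 2 * β * ∑' j, d j) :=
    (h.hasSum_sq.mul_left _).add (h.summable_noncentrality.hasSum.mul_left _)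
  have hterm (j : ℕ) : ‖cumulantTerm (b j) (d j) z - z ^ 2 * (b j ^ 2 : ℝ)‖ ≤
      4 * ‖z‖ ^ 3 * β * b j ^ 2 + 4 * ‖z‖ ^ 2 * β * d j := by
    have hd := h.nonneg_noncentrality j
    refine (norm_cumulantTerm_sub_le (h.nonneg j) hd (h.mul_weight_le hz j)).trans ?_
    rw [pow_succ' (b j), ← mul_assoc]
    gcongr <;> exact h.le_bound j
  have heq : z ^ 2 / 2 = z ^ 2 * (1 / 2 : ℝ) := by push_cast; ring
  rw [heq, ← hdiff.tsum_eq]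
  exact (tsum_of_norm_bounded hbound hterm).trans_eq (by ring)

/-- The exponent `2` makes the Laplace transform integrable along vertical lines, uniformly over
weight systems. -/
theorem re_cumulant_le (h : IsWeightSystem b d β) (hβ : β ≤ 1 / 4) (ht : |t| * β ≤ 1 / 4) (u : ℝ) :
    (cumulant b d (t + u * I)).re ≤ (cumulant b d t).re - 2 * Real.log (1 + u ^ 2 / 16) := by
  have ht' : t * β ≤ 1 / 4 := (mul_le_mul_of_nonneg_right (le_abs_self t) h.bound_nonneg).trans ht
  have hvertical := Complex.hasSum_re
    (h.summable_cumulantTerm (z := t + u * I) (by simpa using ht')).hasSum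
  have hreal := Complex.hasSum_re (h.summable_cumulantTerm (z := t) (by simpa using ht')).hasSum
  refine (hasSum_le (fun j => re_cumulantTerm_le (h.nonneg j) ((h.le_bound j).trans hβ)
    (h.nonneg_noncentrality j) (h.mul_weight_le ht j)) hvertical
    (hreal.sub (h.hasSum_sq.mul_left (4 * Real.log (1 + u ^ 2 / 16))))).trans_eq ?_
  rw [cumulant]; ring

end IsWeightSystem

end Cumulant

/-- A random variable whose complex moment generating function has a logarithm `K` that deviates
from the standard Gaussian one, `z ^ 2 / 2`, by a third order term of size `β` and a second order
term of size `β * B`, and that decays along vertical lines when `β` is small. -/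
structure NearGaussian {Ω : Type*} [MeasurableSpace Ω] (P : Measure Ω) (X : Ω → ℝ) (β B : ℝ) :
    Prop where
  aemeasurable : AEMeasurable X P
  bound_nonneg : 0 ≤ β
  integrable_exp : ∀ t : ℝ, |t| * β ≤ 1 / 4 → Integrable (fun ω => Real.exp (t * X ω)) P
  exists_cumulant : ∃ K : ℂ → ℂ,
    (∀ z : ℂ, |z.re| * β ≤ 1 / 4 → complexMGF X P z = Complex.exp (K z)) ∧
    (∀ z : ℂ, ‖z‖ * β ≤ 1 / 4 → ‖K z - z ^ 2 / 2‖ ≤ β * (2 * ‖z‖ ^ 3 + 4 * ‖z‖ ^ 2 * B)) ∧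
    (β ≤ 1 / 4 → ∀ t u : ℝ, |t| * β ≤ 1 / 4 →
      (K (t + u * I)).re ≤ (K t).re - 2 * Real.log (1 + u ^ 2 / 16))

section SingleVariable

variable {Ω : Type*} [MeasurableSpace Ω] {P : Measure Ω} {X : Ω → ℝ}

lemma cgf_eq_re_of_complexMGF_eq_exp {K : ℂ} {t : ℝ} (h : complexMGF X P t = Complex.exp K) :
    cgf X P t = K.re := by
  have hnorm := congrArg norm h
  rw [complexMGF_ofReal, Complex.norm_real, Complex.norm_exp,
    Real.norm_of_nonneg mgf_nonneg] at hnorm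
  rw [cgf, hnorm, Real.log_exp]

lemma NearGaussian.neg {β B : ℝ} (h : NearGaussian P X β B) :
    NearGaussian P (fun ω => -X ω) β B where
  aemeasurable := h.aemeasurable.neg
  bound_nonneg := h.bound_nonneg
  integrable_exp t ht := by simpa using h.integrable_exp (-t) (by rwa [abs_neg])
  exists_cumulant := by
    obtain ⟨K, hK_exp, hK_near, hK_decay⟩ := h.exists_cumulant
    refine ⟨fun z => K (-z), fun z hz => ?_, fun z hz => ?_, fun hβ t u ht => ?_⟩
    · rw [← hK_exp (-z) (by simpa using hz)]
      simp [complexMGF]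
    · simpa using hK_near (-z) (by simpa using hz)
    · have hneg := hK_decay hβ (-t) (-u) (by rwa [abs_neg])
      have harg : (-(t + u * I) : ℂ) = (-t : ℝ) + (-u : ℝ) * I := by push_cast; ring
      beta_reduce
      rwa [harg, ← Complex.ofReal_neg t, ← neg_sq u]

lemma NearGaussian.abs_cgf_sub_le {β B t : ℝ} (h : NearGaussian P X β B) (ht : |t| * β ≤ 1 / 4) :
    |cgf X P t - t ^ 2 / 2| ≤ β * (2 * |t| ^ 3 + 4 * t ^ 2 * B) := by
  obtain ⟨K, hK_exp, hK_near, -⟩ := h.exists_cumulant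
  have hre : (K t - (t : ℂ) ^ 2 / 2).re = cgf X P t - t ^ 2 / 2 := by
    have hsq : (t : ℂ) ^ 2 / 2 = ((t ^ 2 / 2 : ℝ) : ℂ) := by push_cast; rfl
    rw [cgf_eq_re_of_complexMGF_eq_exp (hK_exp t (by simpa using ht)), Complex.sub_re, hsq,
      Complex.ofReal_re]
  rw [← hre]
  simpa using (Complex.abs_re_le_norm _).trans (hK_near t (by simpa using ht))

/-- Below `x` and above `z` the exponential `exp (t * v)` is dominated by its tilts by `∓s`. -/
lemma exp_mul_le_indicator_add {t s : ℝ} (ht : 0 ≤ t) (hs : 0 ≤ s) (x z v : ℝ) :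
    Real.exp (t * v) ≤ (Set.Ioi x).indicator (fun _ => Real.exp (t * z)) v +
      Real.exp (s * x) * Real.exp ((t - s) * v) +
      Real.exp (-(s * z)) * Real.exp ((t + s) * v) := by
  have hind : 0 ≤ (Set.Ioi x).indicator (fun _ => Real.exp (t * z)) v :=
    Set.indicator_nonneg (fun _ _ => (Real.exp_pos _).le) _
  have hlow := Real.exp_pos (s * x + (t - s) * v)
  have hhigh := Real.exp_pos (-(s * z) + (t + s) * v)
  rw [← Real.exp_add, ← Real.exp_add]
  rcases le_or_gt v x with hx | hx
  · have : Real.exp (t * v) ≤ Real.exp (s * x + (t - s) * v) := by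
      rw [Real.exp_le_exp]; nlinarith
    linarith
  rcases le_or_gt z v with hz | hz
  · have : Real.exp (t * v) ≤ Real.exp (-(s * z) + (t + s) * v) := by
      rw [Real.exp_le_exp]; nlinarith
    linarith
  · rw [Set.indicator_of_mem (Set.mem_Ioi.2 hx)]
    have : Real.exp (t * v) ≤ Real.exp (t * z) := by gcongr
    linarith

lemma mgf_sub_le_exp_mul_measureReal [IsFiniteMeasure P] (hX : AEMeasurable X P)
    {t s : ℝ} (ht : 0 ≤ t) (hs : 0 ≤ s) (hint : Integrable (fun ω => Real.exp (t * X ω)) P)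
    (hint_sub : Integrable (fun ω => Real.exp ((t - s) * X ω)) P)
    (hint_add : Integrable (fun ω => Real.exp ((t + s) * X ω)) P) (x z : ℝ) :
    mgf X P t - Real.exp (s * x) * mgf X P (t - s) - Real.exp (-(s * z)) * mgf X P (t + s) ≤
      Real.exp (t * z) * P.real {ω | x < X ω} := by
  have hmeas : NullMeasurableSet {ω | x < X ω} P := nullMeasurableSet_lt aemeasurable_const hX
  have hint_ind : Integrable ({ω | x < X ω}.indicator fun _ => Real.exp (t * z)) P :=
    (integrable_const _).indicator₀ hmeas
  have hint_low := hint_ind.add (hint_sub.const_mul (Real.exp (s * x)))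
  have hmono := integral_mono hint (hint_low.add (hint_add.const_mul (Real.exp (-(s * z)))))
    fun ω => exp_mul_le_indicator_add ht hs x z (X ω)
  rw [integral_add' hint_low (hint_add.const_mul _),
    integral_add' hint_ind (hint_sub.const_mul _), integral_const_mul, integral_const_mul,
    integral_indicator₀ hmeas, setIntegral_const, smul_eq_mul] at hmono
  simp only [mgf]
  linarith

/-- The tilted law `exp (t * X) P / mgf X P t` gives mass at least `1 / 2` to `(x, z)` as soon as
tilting further by `-s` and by `s` shows that it gives mass at most `1 / 4` to each side. -/
lemma exp_cgf_sub_le_measureReal [IsProbabilityMeasure P] (hX : AEMeasurable X P) {t s x z : ℝ}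
    (ht : 0 ≤ t) (hs : 0 ≤ s) (hint : Integrable (fun ω => Real.exp (t * X ω)) P)
    (hint_sub : Integrable (fun ω => Real.exp ((t - s) * X ω)) P)
    (hint_add : Integrable (fun ω => Real.exp ((t + s) * X ω)) P)
    (hlow : s * x + cgf X P (t - s) + Real.log 4 ≤ cgf X P t)
    (hhigh : cgf X P (t + s) - s * z + Real.log 4 ≤ cgf X P t) :
    Real.exp (cgf X P t - t * z - Real.log 2) ≤ P.real {ω | x < X ω} := by
  have hmass := mgf_sub_le_exp_mul_measureReal hX ht hs hint hint_sub hint_add x z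
  rw [← exp_cgf hint, ← exp_cgf hint_sub, ← exp_cgf hint_add, ← Real.exp_add,
    ← Real.exp_add] at hmass
  have hlow' := Real.exp_le_exp.2 hlow
  have hhigh' := Real.exp_le_exp.2 hhigh
  rw [Real.exp_add, Real.exp_log (by norm_num)] at hlow' hhigh'
  rw [neg_add_eq_sub] at hmass
  rw [Real.exp_sub, Real.exp_sub, Real.exp_log two_pos, div_div, div_le_iff₀ (by positivity)]
  linarith

end SingleVariable

section Family

variable {ι : Type*} {l : Filter ι} {β B y : ι → ℝ}

lemma eventually_add_le_of_tendsto_div {f g v : ι → ℝ} {a b : ℝ} (hv : Tendsto v l atTop)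
    (hf : Tendsto (fun i => f i / v i) l (𝓝 a)) (hg : Tendsto (fun i => g i / v i) l (𝓝 b))
    (hab : a < b) (c : ℝ) : ∀ᶠ i in l, f i + c ≤ g i := by
  have hlim : Tendsto (fun i => f i / v i + c / v i) l (𝓝 (a + 0)) :=
    hf.add (tendsto_const_nhds.div_atTop hv)
  filter_upwards [hlim.eventually_lt hg (by rwa [add_zero]), hv.eventually_gt_atTop 0] with i hi hvi
  rw [← add_div, div_lt_div_iff_of_pos_right hvi] at hi
  exact hi.le

lemma eventually_abs_mul_mul_le {f : ι → ℝ} (h : Tendsto (fun i => β i * f i) l (𝓝 0)) (s : ℝ)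
    (hf : ∀ᶠ i in l, 0 ≤ f i) : ∀ᶠ i in l, |s * f i| * β i ≤ 1 / 4 := by
  have hlim := h.const_mul |s|
  rw [mul_zero] at hlim
  filter_upwards [hlim.eventually_le_const (show (0 : ℝ) < 1 / 4 by norm_num), hf] with i hi hfi
  rw [abs_mul, abs_of_nonneg hfi]
  linarith

variable {Ω : Type*} [MeasurableSpace Ω] {P : Measure Ω} {X : ι → Ω → ℝ}

lemma tendsto_cgf_div_sq (hX : ∀ᶠ i in l, NearGaussian P (X i) (β i) (B i))
    (hy : ∀ᶠ i in l, 0 < y i) (hβy : Tendsto (fun i => β i * y i) l (𝓝 0))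
    (hβB : Tendsto (fun i => β i * B i) l (𝓝 0)) (s : ℝ) :
    Tendsto (fun i => cgf (X i) P (s * y i) / y i ^ 2) l (𝓝 (s ^ 2 / 2)) := by
  rw [tendsto_iff_norm_sub_tendsto_zero]
  have hlim : Tendsto (fun i => 2 * |s| ^ 3 * (β i * y i) + 4 * s ^ 2 * (β i * B i)) l (𝓝 0) := by
    simpa using (hβy.const_mul (2 * |s| ^ 3)).add (hβB.const_mul (4 * s ^ 2))
  refine squeeze_zero' (Eventually.of_forall fun _ => norm_nonneg _) ?_ hlim
  filter_upwards [hX, hy, eventually_abs_mul_mul_le hβy s (hy.mono fun _ h => h.le)]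
    with i hXi hyi hsi
  have heq : cgf (X i) P (s * y i) / y i ^ 2 - s ^ 2 / 2 =
      (cgf (X i) P (s * y i) - (s * y i) ^ 2 / 2) / y i ^ 2 := by field_simp
  rw [heq, Real.norm_eq_abs, abs_div, abs_of_pos (by positivity : 0 < y i ^ 2),
    div_le_iff₀ (by positivity)]
  refine (hXi.abs_cgf_sub_le hsi).trans_eq ?_
  rw [abs_mul, abs_of_pos hyi]
  ring

variable [IsProbabilityMeasure P]

theorem exists_pos_le_measureReal_pos (hX : ∀ᶠ i in l, NearGaussian P (X i) (β i) (B i))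
    (hβ : Tendsto β l (𝓝 0)) (hβB : Tendsto (fun i => β i * B i) l (𝓝 0)) :
    ∃ c > 0, ∀ᶠ i in l, c ≤ P.real {ω | 0 < X i ω} := by
  have hcgf (s : ℝ) : Tendsto (fun i => cgf (X i) P s) l (𝓝 (s ^ 2 / 2)) := by
    simpa using tendsto_cgf_div_sq (y := fun _ => 1) hX (Eventually.of_forall fun _ => one_pos)
      (by simpa using! hβ) hβB s
  have hdomain (s : ℝ) : ∀ᶠ i in l, |s| * β i ≤ 1 / 4 := by
    simpa using eventually_abs_mul_mul_le (f := fun _ => 1) (by simpa using! hβ) s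
      (Eventually.of_forall fun _ => zero_le_one)
  have hlog : Real.log 4 < 3 / 2 := by
    rw [show (4 : ℝ) = 2 ^ 2 by norm_num, Real.log_pow]
    push_cast
    linarith [Real.log_two_lt_d9]
  refine ⟨Real.exp (-8), Real.exp_pos _, ?_⟩
  filter_upwards [hX, (hcgf 2).eventually_const_lt (u := 7 / 4) (by norm_num),
    (hcgf 4).eventually_lt_const (u := 33 / 4) (by norm_num), hdomain 2, hdomain 4]
    with i hXi hcgf2 hcgf4 hdom2 hdom4
  refine (Real.exp_le_exp.2 ?_).trans (exp_cgf_sub_le_measureReal hXi.aemeasurable (t := 2)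
    (s := 2) (z := 4) two_pos.le two_pos.le (hXi.integrable_exp _ hdom2) (by simp) ?_ ?_ ?_)
  · linarith [Real.log_two_lt_d9]
  · norm_num
    exact hXi.integrable_exp _ hdom4
  · norm_num
    linarith
  · norm_num
    linarith

lemma eventually_exp_cgf_sub_le_measureReal (hX : ∀ᶠ i in l, NearGaussian P (X i) (β i) (B i))
    (hy : Tendsto y l atTop) (hβy : Tendsto (fun i => β i * y i) l (𝓝 0))
    (hβB : Tendsto (fun i => β i * B i) l (𝓝 0)) {η : ℝ} (hη : 0 < η) :
    ∀ᶠ i in l, Real.exp (cgf (X i) P ((1 + η) * y i) - (1 + η) * y i * ((1 + 2 * η) * y i) -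
      Real.log 2) ≤ P.real {ω | y i < X i ω} := by
  have hy_pos : ∀ᶠ i in l, 0 < y i := hy.eventually_gt_atTop 0
  have hy_sq : Tendsto (fun i => y i ^ 2) l atTop := (tendsto_pow_atTop two_ne_zero).comp hy
  have hcgf := tendsto_cgf_div_sq hX hy_pos hβy hβB
  have hdomain (s : ℝ) := eventually_abs_mul_mul_le hβy s (hy_pos.mono fun _ h => h.le)
  have hlow : ∀ᶠ i in l, η * y i * y i + cgf (X i) P (1 * y i) + Real.log 4 ≤
      cgf (X i) P ((1 + η) * y i) := by
    refine eventually_add_le_of_tendsto_div hy_sq (((hcgf 1).const_add η).congr' ?_)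
      (hcgf (1 + η)) (by nlinarith) _
    filter_upwards [hy_pos] with i hyi
    field_simp
  have hhigh : ∀ᶠ i in l, cgf (X i) P ((1 + 2 * η) * y i) - η * y i * ((1 + 2 * η) * y i) +
      Real.log 4 ≤ cgf (X i) P ((1 + η) * y i) := by
    refine eventually_add_le_of_tendsto_div hy_sq
      (((hcgf (1 + 2 * η)).sub_const (η * (1 + 2 * η))).congr' ?_) (hcgf (1 + η)) (by nlinarith) _
    filter_upwards [hy_pos] with i hyi
    field_simp
  filter_upwards [hX, hy_pos, hlow, hhigh, hdomain 1, hdomain (1 + η), hdomain (1 + 2 * η)]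
    with i hXi hyi hlow_i hhigh_i hdom_low hdom hdom_high
  have hsub : (1 + η) * y i - η * y i = 1 * y i := by ring
  have hadd : (1 + η) * y i + η * y i = (1 + 2 * η) * y i := by ring
  exact exp_cgf_sub_le_measureReal (s := η * y i) hXi.aemeasurable (by positivity) (by positivity)
    (hXi.integrable_exp _ hdom) (hsub ▸ hXi.integrable_exp _ hdom_low)
    (hadd ▸ hXi.integrable_exp _ hdom_high) (hsub ▸ hlow_i) (hadd ▸ hhigh_i)

lemma eventually_measureReal_lt_pos (hX : ∀ᶠ i in l, NearGaussian P (X i) (β i) (B i))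
    (hy : Tendsto y l atTop) (hβy : Tendsto (fun i => β i * y i) l (𝓝 0))
    (hβB : Tendsto (fun i => β i * B i) l (𝓝 0)) : ∀ᶠ i in l, 0 < P.real {ω | y i < X i ω} :=
  (eventually_exp_cgf_sub_le_measureReal hX hy hβy hβB one_pos).mono
    fun _ h => (Real.exp_pos _).trans_le h

lemma eventually_lt_log_measureReal_div_sq (hX : ∀ᶠ i in l, NearGaussian P (X i) (β i) (B i))
    (hy : Tendsto y l atTop) (hβy : Tendsto (fun i => β i * y i) l (𝓝 0))
    (hβB : Tendsto (fun i => β i * B i) l (𝓝 0)) {a : ℝ} (ha : a < -(1 / 2)) :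
    ∀ᶠ i in l, a < Real.log (P.real {ω | y i < X i ω}) / y i ^ 2 := by
  have hy_pos : ∀ᶠ i in l, 0 < y i := hy.eventually_gt_atTop 0
  have hy_sq : Tendsto (fun i => y i ^ 2) l atTop := (tendsto_pow_atTop two_ne_zero).comp hy
  have hrate : Tendsto (fun η : ℝ => (1 + η) ^ 2 / 2 - (1 + η) * (1 + 2 * η)) (𝓝[>] 0)
      (𝓝 (-(1 / 2))) := by
    have hcont : Continuous fun η : ℝ => (1 + η) ^ 2 / 2 - (1 + η) * (1 + 2 * η) := by fun_prop
    refine (hcont.tendsto' 0 _ (by norm_num)).mono_left nhdsWithin_le_nhds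
  obtain ⟨η, haη, hη⟩ := ((hrate.eventually_const_lt ha).and self_mem_nhdsWithin).exists
  have hlim : Tendsto (fun i => cgf (X i) P ((1 + η) * y i) / y i ^ 2 -
      (1 + η) * (1 + 2 * η) - Real.log 2 / y i ^ 2) l
        (𝓝 ((1 + η) ^ 2 / 2 - (1 + η) * (1 + 2 * η) - 0)) :=
    ((tendsto_cgf_div_sq hX hy_pos hβy hβB (1 + η)).sub_const _).sub
      (tendsto_const_nhds.div_atTop hy_sq)
  filter_upwards [hlim.eventually_const_lt (by rwa [sub_zero]), hy_pos,
    eventually_exp_cgf_sub_le_measureReal hX hy hβy hβB hη,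
    eventually_measureReal_lt_pos hX hy hβy hβB] with i ha_i hyi hexp hpos
  refine ha_i.trans_le ?_
  rw [le_div_iff₀ (by positivity)]
  refine le_trans (le_of_eq ?_) ((Real.le_log_iff_exp_le hpos).2 hexp)
  field_simp

lemma eventually_log_measureReal_div_sq_lt (hX : ∀ᶠ i in l, NearGaussian P (X i) (β i) (B i))
    (hy : ∀ᶠ i in l, 0 < y i) (hβy : Tendsto (fun i => β i * y i) l (𝓝 0))
    (hβB : Tendsto (fun i => β i * B i) l (𝓝 0)) (hpos : ∀ᶠ i in l, 0 < P.real {ω | y i ≤ X i ω})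
    {a : ℝ} (ha : -(1 / 2) < a) :
    ∀ᶠ i in l, Real.log (P.real {ω | y i ≤ X i ω}) / y i ^ 2 < a := by
  have hlim : Tendsto (fun i => cgf (X i) P (1 * y i) / y i ^ 2 - 1) l (𝓝 (1 ^ 2 / 2 - 1)) :=
    (tendsto_cgf_div_sq hX hy hβy hβB 1).sub_const 1
  filter_upwards [hlim.eventually_lt_const (lt_of_eq_of_lt (by norm_num) ha), hX, hy, hpos,
    eventually_abs_mul_mul_le hβy 1 (hy.mono fun _ h => h.le)] with i ha_i hXi hyi hpos_i hdom
  rw [one_mul] at ha_i hdom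
  have hchernoff := (Real.log_le_iff_le_exp hpos_i).2
    (measure_ge_le_exp_cgf (y i) hyi.le (hXi.integrable_exp _ hdom))
  refine lt_of_le_of_lt ?_ ha_i
  rw [div_le_iff₀ (by positivity)]
  refine hchernoff.trans_eq ?_
  field_simp
  ring

theorem tendsto_log_tail_div_sq (hX : ∀ᶠ i in l, NearGaussian P (X i) (β i) (B i))
    (hy : Tendsto y l atTop) (hβy : Tendsto (fun i => β i * y i) l (𝓝 0))
    (hβB : Tendsto (fun i => β i * B i) l (𝓝 0)) {p : ι → ℝ}
    (hp_ge : ∀ᶠ i in l, P.real {ω | y i < X i ω} ≤ p i)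
    (hp_le : ∀ᶠ i in l, p i ≤ P.real {ω | y i ≤ X i ω}) :
    Tendsto (fun i => Real.log (p i) / y i ^ 2) l (𝓝 (-(1 / 2))) := by
  have hpos := eventually_measureReal_lt_pos hX hy hβy hβB
  have hpos_le : ∀ᶠ i in l, 0 < P.real {ω | y i ≤ X i ω} := by
    filter_upwards [hpos, hp_ge, hp_le] with i h hge hle using h.trans_le (hge.trans hle)
  refine tendsto_order.2 ⟨fun a ha => ?_, fun a ha => ?_⟩
  · filter_upwards [eventually_lt_log_measureReal_div_sq hX hy hβy hβB ha, hpos, hp_ge]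
      with i hi hpos_i hge
    exact hi.trans_le (by gcongr)
  · filter_upwards [eventually_log_measureReal_div_sq_lt hX (hy.eventually_gt_atTop 0) hβy hβB
      hpos_le ha, hpos, hp_ge, hp_le] with i hi hpos_i hge hle
    have := hpos_i.trans_le hge
    exact lt_of_le_of_lt (by gcongr) hi

end Family

section NormalQuantile

variable {ι : Type*} {l : Filter ι} {y p : ι → ℝ}

theorem isEquivalent_sqrt_abs_log (hy : Tendsto y l atTop)
    (h : Tendsto (fun i => Real.log (p i) / y i ^ 2) l (𝓝 (-(1 / 2)))) :
    (fun i => √(2 * |Real.log (p i)|)) ~[l] y := by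
  have hy_pos : ∀ᶠ i in l, 0 < y i := hy.eventually_gt_atTop 0
  refine (isEquivalent_iff_tendsto_one (hy_pos.mono fun i h => h.ne')).2 ?_
  have hsqrt : Tendsto (fun i => √(2 * |Real.log (p i) / y i ^ 2|)) l (𝓝 √(2 * |-(1 / 2)|)) :=
    (Real.continuous_sqrt.tendsto _).comp (h.abs.const_mul 2)
  have hone : √(2 * |(-(1 / 2) : ℝ)|) = 1 := by norm_num
  rw [hone] at hsqrt
  refine hsqrt.congr' ?_
  filter_upwards [hy_pos] with i hyi
  rw [Pi.div_apply, abs_div, abs_of_pos (by positivity : 0 < y i ^ 2), ← mul_div_assoc,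
    Real.sqrt_div' _ (by positivity), Real.sqrt_sq hyi.le]

theorem tendsto_zero_of_tendsto_log_div_sq (hy : Tendsto y l atTop) (hp : ∀ᶠ i in l, 0 < p i)
    (h : Tendsto (fun i => Real.log (p i) / y i ^ 2) l (𝓝 (-(1 / 2)))) : Tendsto p l (𝓝 0) := by
  have hy_sq : Tendsto (fun i => y i ^ 2) l atTop := (tendsto_pow_atTop two_ne_zero).comp hy
  refine (Real.tendsto_exp_atBot.comp (hy_sq.atTop_mul_neg (by norm_num) h)).congr' ?_
  filter_upwards [hp, hy.eventually_gt_atTop 0] with i hpi hyi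
  rw [Function.comp_apply, mul_div_cancel₀ _ (by positivity), Real.exp_log hpi]

end NormalQuantile

section LargeShift

variable {Ω : Type*} [MeasurableSpace Ω] {P : Measure Ω} [IsFiniteMeasure P]

lemma NearGaussian.measureReal_le_exp_sq_sub {X : Ω → ℝ} {β B C t y : ℝ}
    (h : NearGaussian P X β B) (hB : 0 ≤ B) (hC : 0 < C) (hy : B ≤ C * y) (ht : 0 ≤ t)
    (htβ : t * β ≤ 1 / (8 * (C + 1))) :
    P.real {ω | y ≤ X ω} ≤ Real.exp (t ^ 2 - t * B / (2 * C)) := by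
  have hdom : t * β ≤ 1 / 4 := htβ.trans (one_div_le_one_div_of_le (by norm_num) (by linarith))
  have habs : |t| * β ≤ 1 / 4 := by rwa [abs_of_nonneg ht]
  have hcgf := (abs_le.1 (h.abs_cgf_sub_le habs)).2
  rw [abs_of_nonneg ht] at hcgf
  have hthreshold : t * B / C ≤ t * y := by
    rw [div_le_iff₀ hC, mul_assoc, mul_comm y]
    gcongr
  have hthird : β * (2 * t ^ 3) ≤ t ^ 2 / 2 := by
    nlinarith [mul_le_mul_of_nonneg_left hdom (sq_nonneg t)]
  have hdomC : 4 * (t * β) ≤ 1 / (2 * C) := by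
    calc 4 * (t * β) ≤ 4 * (1 / (8 * (C + 1))) := by gcongr
      _ = 1 / (2 * (C + 1)) := by field_simp; norm_num
      _ ≤ 1 / (2 * C) := by gcongr; linarith
  have hsecond : β * (4 * t ^ 2 * B) ≤ t * B / (2 * C) := by
    calc β * (4 * t ^ 2 * B) = t * B * (4 * (t * β)) := by ring
      _ ≤ t * B * (1 / (2 * C)) := by gcongr
      _ = t * B / (2 * C) := mul_one_div _ _
  have hhalves : t * B / C = t * B / (2 * C) + t * B / (2 * C) := by
    field_simp
    norm_num
  refine (measure_ge_le_exp_cgf y ht (h.integrable_exp t habs)).trans (Real.exp_le_exp.2 ?_)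
  linarith

variable {ι : Type*} {l : Filter ι} {X : ι → Ω → ℝ} {β B r y p : ι → ℝ} {C M : ℝ}

theorem tendsto_inv_sq_mul_abs_log_atTop
    (hX : ∀ᶠ i in l, NearGaussian P (X i) (β i) (B i)) (hr : Tendsto r l atTop) (hM : 0 < M)
    (hβr : ∀ᶠ i in l, β i * r i ≤ M) (hBr : Tendsto (fun i => B i / r i) l atTop) (hC : 0 < C)
    (hy : ∀ᶠ i in l, B i ≤ C * y i) (hp_pos : ∀ᶠ i in l, 0 < p i)
    (hp_le : ∀ᶠ i in l, p i ≤ P.real {ω | y i ≤ X i ω}) :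
    Tendsto (fun i => (r i ^ 2)⁻¹ * |Real.log (p i)|) l atTop := by
  set η := 1 / (8 * (C + 1)) / M
  have hη_pos : 0 < η := by positivity
  have hlower : Tendsto (fun i => η / (2 * C) * (B i / r i) - η ^ 2) l atTop :=
    tendsto_atTop_add_const_right _ _ (hBr.const_mul_atTop (by positivity))
  refine tendsto_atTop_mono' _ ?_ hlower
  filter_upwards [hX, hβr, hy, hp_pos, hp_le, hr.eventually_gt_atTop 0,
    hBr.eventually_ge_atTop 0] with i hXi hβri hyi hpi_pos hpi_le hri hBri
  have hBi : 0 ≤ B i := by simpa [hri.ne'] using mul_nonneg hBri hri.le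
  have htβ : η * r i * β i ≤ 1 / (8 * (C + 1)) := by
    calc η * r i * β i = η * (β i * r i) := by ring
      _ ≤ η * M := by gcongr
      _ = 1 / (8 * (C + 1)) := div_mul_cancel₀ _ hM.ne'
  have htail := hpi_le.trans (hXi.measureReal_le_exp_sq_sub hBi hC hyi (by positivity) htβ)
  have hlog : Real.log (p i) ≤ (η * r i) ^ 2 - η * r i * B i / (2 * C) :=
    (Real.log_le_iff_le_exp hpi_pos).2 htail
  rw [inv_mul_eq_div, le_div_iff₀ (by positivity)]
  calc (η / (2 * C) * (B i / r i) - η ^ 2) * r i ^ 2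
      = -((η * r i) ^ 2 - η * r i * B i / (2 * C)) := by
        field_simp
        ring
    _ ≤ -Real.log (p i) := neg_le_neg hlog
    _ ≤ |Real.log (p i)| := neg_le_abs _

end LargeShift

section StandardNormal

lemma exp_le_gaussianPDFReal_of_le_add_inv {y v : ℝ} (hy : 1 ≤ y) (hv : v ∈ Set.Icc y (y + y⁻¹)) :
    (√(2 * π))⁻¹ * Real.exp (-(y ^ 2 / 2) - 3 / 2) ≤ gaussianPDFReal 0 1 v := by
  have hinv : y⁻¹ ^ 2 ≤ 1 := pow_le_one₀ (by positivity) (inv_le_one_of_one_le₀ hy)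
  have hsq : v ^ 2 ≤ y ^ 2 + 2 + y⁻¹ ^ 2 :=
    calc v ^ 2 ≤ (y + y⁻¹) ^ 2 := pow_le_pow_left₀ (by linarith [hv.1]) hv.2 2
      _ = y ^ 2 + 2 + y⁻¹ ^ 2 := by field_simp; ring
  simp only [gaussianPDFReal, NNReal.coe_one, mul_one, sub_zero]
  gcongr
  linarith

lemma measureReal_gaussianReal_eq_setIntegral (s : Set ℝ) :
    (gaussianReal 0 1).real s = ∫ v in s, gaussianPDFReal 0 1 v := by
  rw [measureReal_def, gaussianReal_apply_eq_integral _ one_ne_zero, ENNReal.toReal_ofReal]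
  exact integral_nonneg (gaussianPDFReal_nonneg 0 1)

lemma le_mul_exp_mul_measureReal_gaussianReal {y : ℝ} (hy : 1 ≤ y) :
    (√(2 * π))⁻¹ * Real.exp (-(3 / 2)) ≤
      y * Real.exp (y ^ 2 / 2) * (gaussianReal 0 1).real {v | y < v} := by
  set c := (√(2 * π))⁻¹ * Real.exp (-(y ^ 2 / 2) - 3 / 2) with hc
  have hvolume : ∫ _v in Set.Icc y (y + y⁻¹), c = y⁻¹ * c := by
    rw [setIntegral_const, smul_eq_mul, Real.volume_real_Icc_of_le (by simp; linarith),
      add_sub_cancel_left]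
  have hmass : y⁻¹ * c ≤ (gaussianReal 0 1).real {v | y < v} :=
    calc y⁻¹ * c = ∫ _v in Set.Icc y (y + y⁻¹), c := hvolume.symm
      _ ≤ ∫ v in Set.Icc y (y + y⁻¹), gaussianPDFReal 0 1 v :=
          setIntegral_mono_on (integrableOn_const (by simp))
            (integrable_gaussianPDFReal 0 1).integrableOn measurableSet_Icc
            fun v hv => exp_le_gaussianPDFReal_of_le_add_inv hy hv
      _ ≤ ∫ v in Set.Ici y, gaussianPDFReal 0 1 v :=
          setIntegral_mono_set (integrable_gaussianPDFReal 0 1).integrableOn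
            (ae_of_all _ (gaussianPDFReal_nonneg 0 1)) Set.Icc_subset_Ici_self.eventuallyLE
      _ = (gaussianReal 0 1).real {v | y < v} := by
          rw [integral_Ici_eq_integral_Ioi, measureReal_gaussianReal_eq_setIntegral]; rfl
  calc (√(2 * π))⁻¹ * Real.exp (-(3 / 2)) = y * Real.exp (y ^ 2 / 2) * (y⁻¹ * c) := by
        rw [hc, sub_eq_add_neg, Real.exp_add, Real.exp_neg (y ^ 2 / 2)]
        field_simp
    _ ≤ y * Real.exp (y ^ 2 / 2) * (gaussianReal 0 1).real {v | y < v} := by gcongr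

lemma measureReal_gaussianReal_Ici (y : ℝ) :
    (gaussianReal 0 1).real {v | y ≤ v} = (gaussianReal 0 1).real {v | y < v} := by
  have := nullSingletonClass_gaussianReal (μ := 0) (v := 1) one_ne_zero
  exact measureReal_congr Ioi_ae_eq_Ici.symm

lemma one_sub_Phi (y : ℝ) : 1 - Phi y = (gaussianReal 0 1).real {v | y < v} := by
  rw [Phi, cdf_eq_real, ← probReal_compl_eq_one_sub measurableSet_Iic, Set.compl_Iic]
  rfl

lemma Phi_neg (y : ℝ) : Phi (-y) = (gaussianReal 0 1).real {v | y < v} := by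
  have hsymm : (gaussianReal 0 1).map (fun v => -v) = gaussianReal 0 1 := by
    simpa using gaussianReal_map_neg (μ := 0) (v := 1)
  rw [Phi, cdf_eq_real, ← measureReal_gaussianReal_Ici]
  conv_lhs => rw [← hsymm]
  rw [map_measureReal_apply measurable_neg measurableSet_Iic]
  congr 1
  ext v
  simp

end StandardNormal

section GaussianVerticalLine

lemma verticalMGF_id_gaussianReal (t w : ℝ) :
    verticalMGF id (gaussianReal 0 1) t w = Complex.exp ((t + (2 * π * w : ℝ) * I) ^ 2 / 2) := by
  rw [verticalMGF, complexMGF_id_gaussianReal]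
  simp

lemma norm_cexp_sq_div_two (t u : ℝ) :
    ‖Complex.exp ((t + u * I) ^ 2 / 2)‖ = Real.exp (t ^ 2 / 2) * Real.exp (-(u ^ 2 / 2)) := by
  have hsq : ((t + u * I) ^ 2 / 2 : ℂ) = (t ^ 2 / 2 + -(u ^ 2 / 2) : ℝ) + (t * u : ℝ) * I := by
    push_cast
    linear_combination (u : ℂ) ^ 2 / 2 * Complex.I_sq
  rw [hsq, Complex.norm_exp, ← Real.exp_add, Complex.add_re, Complex.ofReal_re,
    Complex.re_ofReal_mul, Complex.I_re, mul_zero, add_zero]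

lemma sq_le_sq_two_pi_mul_div (w : ℝ) : w ^ 2 ≤ (2 * π * w) ^ 2 / 8 := by
  have hpi : 9 ≤ π ^ 2 := by nlinarith [Real.pi_gt_three]
  have hexpand : (2 * π * w) ^ 2 = 4 * π ^ 2 * w ^ 2 := by ring
  rw [hexpand]
  nlinarith [sq_nonneg w]

lemma exp_neg_sq_two_pi_mul_le (w : ℝ) : Real.exp (-((2 * π * w) ^ 2 / 2)) ≤ (1 + w ^ 2)⁻¹ := by
  rw [Real.exp_neg]
  refine inv_anti₀ (by positivity) ?_
  nlinarith [Real.add_one_le_exp ((2 * π * w) ^ 2 / 2), sq_le_sq_two_pi_mul_div w]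

lemma exp_neg_two_mul_log_le (w : ℝ) :
    Real.exp (-(2 * Real.log (1 + (2 * π * w) ^ 2 / 16))) ≤ (1 + w ^ 2)⁻¹ := by
  have : 0 ≤ (2 * π * w) ^ 2 / 16 := by positivity
  rw [Real.exp_neg]
  refine inv_anti₀ (by positivity) ?_
  rw [two_mul, Real.exp_add, Real.exp_log (by positivity)]
  nlinarith [sq_le_sq_two_pi_mul_div w]

lemma norm_verticalMGF_id_gaussianReal_le (t w : ℝ) :
    ‖verticalMGF id (gaussianReal 0 1) t w‖ ≤ Real.exp (t ^ 2 / 2) * (1 + w ^ 2)⁻¹ := by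
  rw [verticalMGF_id_gaussianReal, norm_cexp_sq_div_two]
  exact mul_le_mul_of_nonneg_left (exp_neg_sq_two_pi_mul_le w) (Real.exp_pos _).le

lemma integrable_verticalMGF_id_gaussianReal (t : ℝ) :
    Integrable (verticalMGF id (gaussianReal 0 1) t) :=
  (integrable_inv_one_add_sq.const_mul (Real.exp (t ^ 2 / 2))).mono'
    (aestronglyMeasurable_verticalMGF aemeasurable_id t)
    (ae_of_all _ fun w => norm_verticalMGF_id_gaussianReal_le t w)

end GaussianVerticalLine

namespace NearGaussian

variable {Ω : Type*} [MeasurableSpace Ω] {P : Measure Ω} {X : Ω → ℝ} {β B t : ℝ}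

lemma mgf_eq_exp_cgf (h : NearGaussian P X β B) (ht : |t| * β ≤ 1 / 4) :
    mgf X P t = Real.exp (cgf X P t) := by
  obtain ⟨K, hK_exp, -, -⟩ := h.exists_cumulant
  have hK := hK_exp t (by simpa using ht)
  rw [cgf_eq_re_of_complexMGF_eq_exp hK, ← Complex.norm_exp, ← hK, complexMGF_ofReal,
    Complex.norm_real, Real.norm_of_nonneg mgf_nonneg]

lemma mgf_le (h : NearGaussian P X β B) (ht : |t| * β ≤ 1 / 4)
    (hsmall : β * (2 * |t| ^ 3 + 4 * t ^ 2 * B) ≤ 1) : mgf X P t ≤ 3 * Real.exp (t ^ 2 / 2) := by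
  have hcgf := (abs_le.1 ((h.abs_cgf_sub_le ht).trans hsmall)).2
  calc mgf X P t = Real.exp (cgf X P t) := h.mgf_eq_exp_cgf ht
    _ ≤ Real.exp (1 + t ^ 2 / 2) := Real.exp_le_exp.2 (by linarith)
    _ = Real.exp 1 * Real.exp (t ^ 2 / 2) := Real.exp_add _ _
    _ ≤ 3 * Real.exp (t ^ 2 / 2) := by gcongr; linarith [Real.exp_one_lt_d9]

lemma norm_verticalMGF_le (h : NearGaussian P X β B) (hβ : β ≤ 1 / 4) (ht : |t| * β ≤ 1 / 4)
    (w : ℝ) : ‖verticalMGF X P t w‖ ≤ mgf X P t * (1 + w ^ 2)⁻¹ := by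
  obtain ⟨K, hK_exp, -, hK_decay⟩ := h.exists_cumulant
  rw [h.mgf_eq_exp_cgf ht, cgf_eq_re_of_complexMGF_eq_exp (hK_exp t (by simpa using ht)),
    verticalMGF, hK_exp _ (by simpa using ht), Complex.norm_exp]
  refine (Real.exp_le_exp.2 (hK_decay hβ t (2 * π * w) ht)).trans ?_
  rw [sub_eq_add_neg, Real.exp_add]
  exact mul_le_mul_of_nonneg_left (exp_neg_two_mul_log_le w) (Real.exp_pos _).le

lemma integrable_verticalMGF [SFinite P] (h : NearGaussian P X β B) (hβ : β ≤ 1 / 4)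
    (ht : |t| * β ≤ 1 / 4) : Integrable (verticalMGF X P t) :=
  (integrable_inv_one_add_sq.const_mul (mgf X P t)).mono'
    (aestronglyMeasurable_verticalMGF h.aemeasurable t)
    (ae_of_all _ fun w => h.norm_verticalMGF_le hβ ht w)

lemma exp_mul_norm_verticalMGF_sub_le (h : NearGaussian P X β B) (hβ : β ≤ 1 / 4)
    (ht : |t| * β ≤ 1 / 4) (hsmall : β * (2 * |t| ^ 3 + 4 * t ^ 2 * B) ≤ 1) (w : ℝ) :
    Real.exp (-(t ^ 2 / 2)) * ‖verticalMGF X P t w - verticalMGF id (gaussianReal 0 1) t w‖ ≤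
      4 * (1 + w ^ 2)⁻¹ := by
  rw [Real.exp_neg, inv_mul_le_iff₀ (Real.exp_pos _)]
  calc ‖verticalMGF X P t w - verticalMGF id (gaussianReal 0 1) t w‖
      ≤ ‖verticalMGF X P t w‖ + ‖verticalMGF id (gaussianReal 0 1) t w‖ := norm_sub_le _ _
    _ ≤ 3 * Real.exp (t ^ 2 / 2) * (1 + w ^ 2)⁻¹ + Real.exp (t ^ 2 / 2) * (1 + w ^ 2)⁻¹ := by
        gcongr
        · refine (h.norm_verticalMGF_le hβ ht w).trans ?_
          gcongr
          exact h.mgf_le ht hsmall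
        · exact norm_verticalMGF_id_gaussianReal_le t w
    _ = Real.exp (t ^ 2 / 2) * (4 * (1 + w ^ 2)⁻¹) := by ring

lemma norm_complexMGF_sub_le (h : NearGaussian P X β B) {z : ℂ} (hz : ‖z‖ * β ≤ 1 / 4)
    (hsmall : β * (2 * ‖z‖ ^ 3 + 4 * ‖z‖ ^ 2 * B) ≤ 1) :
    ‖complexMGF X P z - Complex.exp (z ^ 2 / 2)‖ ≤
      ‖Complex.exp (z ^ 2 / 2)‖ * (2 * (β * (2 * ‖z‖ ^ 3 + 4 * ‖z‖ ^ 2 * B))) := by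
  obtain ⟨K, hK_exp, hK_near, -⟩ := h.exists_cumulant
  have hre : |z.re| * β ≤ 1 / 4 :=
    (mul_le_mul_of_nonneg_right (Complex.abs_re_le_norm z) h.bound_nonneg).trans hz
  have hfactor : complexMGF X P z - Complex.exp (z ^ 2 / 2) =
      Complex.exp (z ^ 2 / 2) * (Complex.exp (K z - z ^ 2 / 2) - 1) := by
    rw [hK_exp z hre, mul_sub, mul_one, ← Complex.exp_add, add_sub_cancel]
  rw [hfactor, norm_mul]
  gcongr
  refine (Complex.norm_exp_sub_one_le ((hK_near z hz).trans hsmall)).trans ?_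
  gcongr
  exact hK_near z hz

lemma mul_exp_mul_abs_tail_sub_le [IsFiniteMeasure P] (h : NearGaussian P X β B)
    (hβ : β ≤ 1 / 4) (ht : 0 < t) (htβ : |t| * β ≤ 1 / 4) {p : ℝ}
    (hp_ge : P.real {ω | t < X ω} ≤ p) (hp_le : p ≤ P.real {ω | t ≤ X ω}) :
    t * Real.exp (t ^ 2 / 2) * |p - (gaussianReal 0 1).real {v | t < v}| ≤
      ∫ w, Real.exp (-(t ^ 2 / 2)) *
        ‖verticalMGF X P t w - verticalMGF id (gaussianReal 0 1) t w‖ := by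
  set q := (gaussianReal 0 1).real {v | t < v} with hq
  have hexp := h.integrable_exp t htβ
  have hdiff := (h.integrable_verticalMGF hβ htβ).sub (integrable_verticalMGF_id_gaussianReal t)
  have hlt := abs_measureReal_lt_sub_le h.aemeasurable aemeasurable_id ht hexp
    (integrable_exp_mul_gaussianReal t) hdiff t
  have hle := abs_measureReal_le_sub_le h.aemeasurable aemeasurable_id ht hexp
    (integrable_exp_mul_gaussianReal t) hdiff t
  simp only [id_eq, measureReal_gaussianReal_Ici, ← hq] at hlt hle
  have hsqueeze : |p - q| ≤ max |P.real {ω | t ≤ X ω} - q| |P.real {ω | t < X ω} - q| :=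
    (abs_sub_le_max_sub hp_ge hp_le q).trans (max_le_max (le_abs_self _) (neg_sub _ q ▸
      neg_le_abs _))
  have hexp_sq : Real.exp (t * t) = Real.exp (t ^ 2 / 2) * Real.exp (t ^ 2 / 2) := by
    rw [← Real.exp_add]; ring_nf
  rw [integral_const_mul, Real.exp_neg, le_inv_mul_iff₀ (Real.exp_pos _)]
  calc Real.exp (t ^ 2 / 2) * (t * Real.exp (t ^ 2 / 2) * |p - q|)
      = t * Real.exp (t * t) * |p - q| := by rw [hexp_sq]; ring
    _ ≤ t * Real.exp (t * t) * max |P.real {ω | t ≤ X ω} - q| |P.real {ω | t < X ω} - q| := by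
        gcongr
    _ ≤ ∫ w, ‖verticalMGF X P t w - verticalMGF id (gaussianReal 0 1) t w‖ := by
        rw [mul_max_of_nonneg _ _ (by positivity)]
        exact max_le hle hlt

end NearGaussian

section Family

variable {ι : Type*} {l : Filter ι} {β B y : ι → ℝ}

lemma tendsto_mul_pow_zero_of_le {f g : ι → ℝ} {m n : ℕ} (hnm : n ≤ m) (hf : ∀ᶠ i in l, 0 ≤ f i)
    (hg : ∀ᶠ i in l, 1 ≤ g i) (h : Tendsto (fun i => f i * g i ^ m) l (𝓝 0)) :
    Tendsto (fun i => f i * g i ^ n) l (𝓝 0) := by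
  refine squeeze_zero' ?_ ?_ h
  · filter_upwards [hf, hg] with i hfi hgi using by positivity
  · filter_upwards [hf, hg] with i hfi hgi
    gcongr

variable {Ω : Type*} [MeasurableSpace Ω] {P : Measure Ω} {X : ι → Ω → ℝ}

lemma tendsto_exp_mul_norm_verticalMGF_sub (hX : ∀ᶠ i in l, NearGaussian P (X i) (β i) (B i))
    (hy : ∀ᶠ i in l, 1 ≤ y i) (hβy : Tendsto (fun i => β i * y i ^ 3) l (𝓝 0))
    (hB : ∀ᶠ i in l, 0 ≤ B i) (hβB : Tendsto (fun i => β i * y i ^ 2 * B i) l (𝓝 0)) (w : ℝ) :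
    Tendsto (fun i => Real.exp (-(y i ^ 2 / 2)) * ‖verticalMGF (X i) P (y i) w -
      verticalMGF id (gaussianReal 0 1) (y i) w‖) l (𝓝 0) := by
  set C := 1 + |2 * π * w|
  have hβ_nonneg : ∀ᶠ i in l, 0 ≤ β i := hX.mono fun i h => h.bound_nonneg
  have hβy1 : Tendsto (fun i => β i * y i) l (𝓝 0) := by
    simpa using tendsto_mul_pow_zero_of_le (n := 1) (by norm_num) hβ_nonneg hy hβy
  have herror : Tendsto (fun i => 2 * C ^ 3 * (β i * y i ^ 3) +
      4 * C ^ 2 * (β i * y i ^ 2 * B i)) l (𝓝 0) := by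
    simpa using (hβy.const_mul (2 * C ^ 3)).add (hβB.const_mul (4 * C ^ 2))
  refine squeeze_zero' (Eventually.of_forall fun i => by positivity) ?_
    (by simpa using herror.const_mul 2)
  filter_upwards [hX, hβ_nonneg, hB, hy, herror.eventually_le_const one_pos,
    eventually_abs_mul_mul_le hβy1 C (hy.mono fun i h => zero_le_one.trans h)]
    with i hXi hβi hBi hyi hsmall hdom
  set z : ℂ := y i + (2 * π * w : ℝ) * I with hz
  have hz_norm : ‖z‖ ≤ C * y i := by
    refine (norm_add_le _ _).trans ?_
    rw [norm_mul, Complex.norm_real, Complex.norm_real, Complex.norm_I, mul_one, Real.norm_eq_abs,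
      Real.norm_eq_abs, abs_of_pos (by linarith)]
    simp only [C]
    nlinarith [abs_nonneg (2 * π * w)]
  have hbound : β i * (2 * ‖z‖ ^ 3 + 4 * ‖z‖ ^ 2 * B i) ≤
      2 * C ^ 3 * (β i * y i ^ 3) + 4 * C ^ 2 * (β i * y i ^ 2 * B i) :=
    calc β i * (2 * ‖z‖ ^ 3 + 4 * ‖z‖ ^ 2 * B i)
        ≤ β i * (2 * (C * y i) ^ 3 + 4 * (C * y i) ^ 2 * B i) := by gcongr
      _ = 2 * C ^ 3 * (β i * y i ^ 3) + 4 * C ^ 2 * (β i * y i ^ 2 * B i) := by ring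
  have hz_dom : ‖z‖ * β i ≤ 1 / 4 :=
    (mul_le_mul_of_nonneg_right (hz_norm.trans (le_abs_self _)) hβi).trans hdom
  have hdecay : ‖Complex.exp (z ^ 2 / 2)‖ ≤ Real.exp (y i ^ 2 / 2) := by
    rw [hz, norm_cexp_sq_div_two]
    exact mul_le_of_le_one_right (Real.exp_pos _).le
      (Real.exp_le_one_iff.2 (by linarith [sq_nonneg (2 * π * w)]))
  rw [verticalMGF_id_gaussianReal, Real.exp_neg, inv_mul_le_iff₀ (Real.exp_pos _)]
  refine (hXi.norm_complexMGF_sub_le hz_dom (hbound.trans hsmall)).trans ?_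
  gcongr

lemma tendsto_integral_exp_mul_norm_verticalMGF_sub [SFinite P] [l.IsCountablyGenerated]
    (hX : ∀ᶠ i in l, NearGaussian P (X i) (β i) (B i))
    (hy : ∀ᶠ i in l, 1 ≤ y i) (hβy : Tendsto (fun i => β i * y i ^ 3) l (𝓝 0))
    (hB : ∀ᶠ i in l, 0 ≤ B i) (hβB : Tendsto (fun i => β i * y i ^ 2 * B i) l (𝓝 0))
    (hβ : ∀ᶠ i in l, β i ≤ 1 / 4) (hdom : ∀ᶠ i in l, |y i| * β i ≤ 1 / 4) :
    Tendsto (fun i => ∫ w, Real.exp (-(y i ^ 2 / 2)) * ‖verticalMGF (X i) P (y i) w -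
      verticalMGF id (gaussianReal 0 1) (y i) w‖) l (𝓝 0) := by
  have hsmall : Tendsto (fun i => β i * (2 * |y i| ^ 3 + 4 * y i ^ 2 * B i)) l (𝓝 0) := by
    have hlim := (hβy.const_mul 2).add (hβB.const_mul 4)
    rw [mul_zero, mul_zero, add_zero] at hlim
    refine hlim.congr' ?_
    filter_upwards [hy] with i hyi
    rw [abs_of_pos (by linarith)]
    ring
  rw [show 𝓝 (0 : ℝ) = 𝓝 (∫ _w : ℝ, (0 : ℝ)) by rw [integral_zero]]
  refine tendsto_integral_filter_of_dominated_convergence (fun w => 4 * (1 + w ^ 2)⁻¹) ?_ ?_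
    (integrable_inv_one_add_sq.const_mul 4)
    (ae_of_all _ (tendsto_exp_mul_norm_verticalMGF_sub hX hy hβy hB hβB))
  · filter_upwards [hX] with i hXi
    exact ((aestronglyMeasurable_verticalMGF hXi.aemeasurable _).sub
      (aestronglyMeasurable_verticalMGF aemeasurable_id _)).norm.const_mul _
  · filter_upwards [hX, hβ, hdom, hsmall.eventually_le_const one_pos] with i hXi hβi hdom_i hsmall_i
    refine ae_of_all _ fun w => ?_
    rw [norm_mul, norm_norm, Real.norm_of_nonneg (Real.exp_pos _).le]
    exact hXi.exp_mul_norm_verticalMGF_sub_le hβi hdom_i hsmall_i w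

theorem isEquivalent_tail [IsFiniteMeasure P] [l.IsCountablyGenerated]
    (hX : ∀ᶠ i in l, NearGaussian P (X i) (β i) (B i)) (hy : ∀ᶠ i in l, 1 ≤ y i)
    (hβy : Tendsto (fun i => β i * y i ^ 3) l (𝓝 0)) (hB : ∀ᶠ i in l, 0 ≤ B i)
    (hβB : Tendsto (fun i => β i * y i ^ 2 * B i) l (𝓝 0)) {p : ι → ℝ}
    (hp_ge : ∀ᶠ i in l, P.real {ω | y i < X i ω} ≤ p i)
    (hp_le : ∀ᶠ i in l, p i ≤ P.real {ω | y i ≤ X i ω}) :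
    p ~[l] fun i => (gaussianReal 0 1).real {v | y i < v} := by
  have hβ_nonneg : ∀ᶠ i in l, 0 ≤ β i := hX.mono fun i h => h.bound_nonneg
  have hβ_lim : Tendsto β l (𝓝 0) := by
    simpa using tendsto_mul_pow_zero_of_le (Nat.zero_le 3) hβ_nonneg hy hβy
  have hβ : ∀ᶠ i in l, β i ≤ 1 / 4 := hβ_lim.eventually_le_const (by norm_num)
  have hdom : ∀ᶠ i in l, |y i| * β i ≤ 1 / 4 := by
    simpa using eventually_abs_mul_mul_le (tendsto_mul_pow_zero_of_le (n := 1) (by norm_num)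
      hβ_nonneg hy hβy) 1 (hy.mono fun i h => by positivity)
  have hlim := tendsto_integral_exp_mul_norm_verticalMGF_sub hX hy hβy hB hβB hβ hdom
  set c := (√(2 * π))⁻¹ * Real.exp (-(3 / 2))
  have hc : 0 < c := by positivity
  refine isLittleO_iff.2 fun a ha => ?_
  filter_upwards [hX, hy, hβ, hdom, hp_ge, hp_le, hlim.eventually_le_const (mul_pos ha hc)]
    with i hXi hyi hβi hdom_i hge hle hint
  have hyi_pos : 0 < y i := zero_lt_one.trans_le hyi
  have hdiff := (hXi.mul_exp_mul_abs_tail_sub_le hβi hyi_pos hdom_i hge hle).trans hint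
  rw [Pi.sub_apply, Real.norm_eq_abs, Real.norm_of_nonneg measureReal_nonneg]
  refine le_of_mul_le_mul_left (a := y i * Real.exp (y i ^ 2 / 2)) ?_ (by positivity)
  calc _ ≤ a * c := hdiff
    _ ≤ a * (y i * Real.exp (y i ^ 2 / 2) * (gaussianReal 0 1).real {v | y i < v}) := by
        gcongr
        exact le_mul_exp_mul_measureReal_gaussianReal hyi
    _ = _ := by ring

end Family

section SquareTerm

/-- The logarithm of the Laplace transform of `b (ξ + τ)²`, where `ξ` is standard normal and
`d = b τ²`. -/
noncomputable def squareTerm (b d : ℝ) (z : ℂ) : ℂ :=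
  -(1 / 2) * Complex.log (1 - 2 * z * b) + z * d / (1 - 2 * z * b)

variable {b d τ : ℝ} {z : ℂ}

lemma squareTerm_eq_cumulantTerm_add (h : (1 - 2 * z * b : ℂ) ≠ 0) :
    squareTerm b d z = cumulantTerm b d z + (z * b + z * d) := by
  have hsplit : z * d / (1 - 2 * z * b) = 2 * z ^ 2 * b * d / (1 - 2 * z * b) + z * d := by
    rw [div_eq_iff h, add_mul, div_mul_cancel₀ _ h]
    ring
  rw [squareTerm, cumulantTerm, hsplit]
  ring

lemma cpow_half_pi_div_half {s : ℂ} (hs : 0 < s.re) :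
    ((π : ℂ) / (s / 2)) ^ (1 / 2 : ℂ) =
      (√(2 * π) : ℝ) * Complex.exp (-(1 / 2) * Complex.log s) := by
  have hs0 : s ≠ 0 := fun h => by simp [h] at hs
  have hpi : 0 < 2 * π := by positivity
  have hdiv : (π : ℂ) / (s / 2) = ((2 * π : ℝ) : ℂ) * s⁻¹ := by push_cast; field_simp
  have harg : s.arg ≠ π := fun h => absurd (Complex.arg_eq_pi_iff.1 h).1 (by linarith)
  rw [hdiv, Complex.cpow_def_of_ne_zero (mul_ne_zero (by exact_mod_cast hpi.ne')
    (inv_ne_zero hs0)), Complex.log_ofReal_mul hpi (inv_ne_zero hs0), Complex.log_inv _ harg,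
    Real.sqrt_eq_rpow, Real.rpow_def_of_pos hpi, Complex.ofReal_exp, ← Complex.exp_add]
  congr 1
  push_cast
  ring

lemma gaussianPDFReal_smul_cexp_mul_sq (b τ : ℝ) (z : ℂ) (v : ℝ) :
    gaussianPDFReal 0 1 v • Complex.exp (z * (b * (v + τ) ^ 2 : ℝ)) =
      ((√(2 * π))⁻¹ : ℝ) * Complex.exp (-((1 - 2 * z * b) / 2) * v ^ 2 + (2 * z * b * τ) * v +
        z * b * τ ^ 2) := by
  rw [gaussianPDFReal, Complex.real_smul, Complex.ofReal_mul, Complex.ofReal_exp, mul_assoc,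
    ← Complex.exp_add]
  simp only [NNReal.coe_one, mul_one, sub_zero]
  congr 2
  push_cast
  ring

lemma integral_cexp_mul_sq_gaussianReal (hz : 0 < (1 - 2 * z * b).re) :
    ∫ v, Complex.exp (z * (b * (v + τ) ^ 2 : ℝ)) ∂gaussianReal 0 1 =
      Complex.exp (squareTerm b (b * τ ^ 2) z) := by
  have hre : (-((1 - 2 * z * b) / 2)).re < 0 := by
    rw [Complex.neg_re, Complex.div_ofNat_re]
    linarith
  have hsqrt : ((√(2 * π))⁻¹ : ℝ) * ((√(2 * π) : ℝ) : ℂ) = 1 := by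
    rw [← Complex.ofReal_mul, inv_mul_cancel₀ (by positivity), Complex.ofReal_one]
  have hne : (1 - 2 * z * b : ℂ) ≠ 0 := fun h => by simp [h] at hz
  have hexponent : z * b * τ ^ 2 - (2 * z * b * τ) ^ 2 / (4 * -((1 - 2 * z * b) / 2)) =
      z * (b * τ ^ 2 : ℝ) / (1 - 2 * z * b) := by
    rw [show (4 : ℂ) * -((1 - 2 * z * b) / 2) = -2 * (1 - 2 * z * b) by ring, sub_eq_iff_eq_add,
      div_add_div _ _ hne (mul_ne_zero (by norm_num) hne),
      eq_div_iff (mul_ne_zero hne (mul_ne_zero (by norm_num) hne))]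
    push_cast
    ring
  simp_rw [integral_gaussianReal_eq_integral_smul one_ne_zero, gaussianPDFReal_smul_cexp_mul_sq]
  rw [integral_const_mul, integral_cexp_quadratic hre, neg_neg, cpow_half_pi_div_half hz,
    hexponent, ← mul_assoc, ← mul_assoc, hsqrt, one_mul, ← Complex.exp_add, squareTerm]

end SquareTerm

section Limits

variable {Ω : Type*} [MeasurableSpace Ω] {P : Measure Ω}

lemma ae_summable_of_summable_integral {f : ℕ → Ω → ℝ} (hf : ∀ j, Integrable (f j) P)
    (hf_nonneg : ∀ j ω, 0 ≤ f j ω) (h : Summable fun j => ∫ ω, f j ω ∂P) :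
    ∀ᵐ ω ∂P, Summable fun j => f j ω := by
  have hmeas (j : ℕ) : AEMeasurable (fun ω => ENNReal.ofReal (f j ω)) P :=
    (hf j).aemeasurable.ennreal_ofReal
  have hfin : ∫⁻ ω, ∑' j, ENNReal.ofReal (f j ω) ∂P ≠ ⊤ := by
    simp_rw [lintegral_tsum hmeas, ← ofReal_integral_eq_lintegral_ofReal (hf _)
      (ae_of_all _ (hf_nonneg _))]
    exact h.tsum_ofReal_ne_top
  filter_upwards [ae_lt_top' (AEMeasurable.tsum hmeas) hfin] with ω hω
  exact (ENNReal.summable_toReal hω.ne).congr fun j => ENNReal.toReal_ofReal (hf_nonneg j ω)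

lemma integrable_of_tendsto_of_tendsto_integral {F : ℕ → Ω → ℝ} {f : Ω → ℝ} {c : ℝ}
    (hF : ∀ N, Integrable (F N) P) (hF_nonneg : ∀ N ω, 0 ≤ F N ω)
    (hlim : ∀ᵐ ω ∂P, Tendsto (fun N => F N ω) atTop (𝓝 (f ω)))
    (hint : Tendsto (fun N => ∫ ω, F N ω ∂P) atTop (𝓝 c)) : Integrable f P := by
  refine ⟨aestronglyMeasurable_of_tendsto_ae _ (fun N => (hF N).aestronglyMeasurable) hlim, ?_⟩
  have hnorm (N : ℕ) : ∫⁻ ω, ‖F N ω‖ₑ ∂P = ENNReal.ofReal (∫ ω, F N ω ∂P) := by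
    rw [← ofReal_integral_norm_eq_lintegral_enorm (hF N)]
    simp_rw [Real.norm_of_nonneg (hF_nonneg N _)]
  calc ∫⁻ ω, ‖f ω‖ₑ ∂P = ∫⁻ ω, liminf (fun N => ‖F N ω‖ₑ) atTop ∂P :=
        lintegral_congr_ae (hlim.mono fun ω hω => hω.enorm.liminf_eq.symm)
    _ ≤ liminf (fun N => ∫⁻ ω, ‖F N ω‖ₑ ∂P) atTop :=
        lintegral_liminf_le' fun N => (hF N).aemeasurable.enorm
    _ = ENNReal.ofReal c := by
        simp_rw [hnorm]
        exact (ENNReal.tendsto_ofReal hint).liminf_eq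
    _ < ⊤ := ENNReal.ofReal_lt_top

end Limits

section QuadForm

variable {Ω : Type*} [MeasurableSpace Ω] {P : Measure Ω}

lemma integrable_add_sq {X : Ω → ℝ} (hX : HasLaw X (gaussianReal 0 1) P) (τ : ℝ) :
    Integrable (fun ω => (X ω + τ) ^ 2) P :=
  (gaussianReal_add_const hX τ).hasGaussianLaw.memLp_two.integrable_sq

lemma integral_add_sq {X : Ω → ℝ} (hX : HasLaw X (gaussianReal 0 1) P) (τ : ℝ) :
    ∫ ω, (X ω + τ) ^ 2 ∂P = 1 + τ ^ 2 := by
  have := hX.isProbabilityMeasure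
  have hY := gaussianReal_add_const hX τ
  have hvar := variance_eq_sub hY.hasGaussianLaw.memLp_two
  rw [hY.variance_eq, hY.integral_eq, integral_id_gaussianReal, variance_id_gaussianReal] at hvar
  simp only [NNReal.coe_one, zero_add, Pi.pow_apply] at hvar
  linarith

/-- The partial sums of a noncentral Gaussian quadratic form. -/
noncomputable def partialForm (b τ : ℕ → ℝ) (ξ : ℕ → Ω → ℝ) (N : ℕ) (ω : Ω) : ℝ :=
  ∑ j ∈ Finset.range N, b j * (ξ j ω + τ j) ^ 2

/-- The noncentral Gaussian quadratic form with weights `b` and shifts `τ`. -/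
noncomputable def quadForm (b τ : ℕ → ℝ) (ξ : ℕ → Ω → ℝ) (ω : Ω) : ℝ :=
  ∑' j, b j * (ξ j ω + τ j) ^ 2

/-- A Gaussian quadratic form, centred at its mean. -/
noncomputable def centredForm (b τ : ℕ → ℝ) (ξ : ℕ → Ω → ℝ) (ω : Ω) : ℝ :=
  quadForm b τ ξ ω - (∑' j, b j + ∑' j, b j * τ j ^ 2)

variable {b τ : ℕ → ℝ} {ξ : ℕ → Ω → ℝ} {β t : ℝ} {z : ℂ}

lemma aemeasurable_partialForm (hξ : ∀ j, HasLaw (ξ j) (gaussianReal 0 1) P) (N : ℕ) :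
    AEMeasurable (partialForm b τ ξ N) P := by
  have := fun j => (hξ j).aemeasurable
  unfold partialForm
  fun_prop

lemma complexMGF_partialForm (hξ : ∀ j, HasLaw (ξ j) (gaussianReal 0 1) P) (hind : iIndepFun ξ P)
    (hz : ∀ j, 0 < (1 - 2 * z * b j).re) (N : ℕ) :
    complexMGF (partialForm b τ ξ N) P z =
      Complex.exp (∑ j ∈ Finset.range N, squareTerm (b j) (b j * τ j ^ 2) z) := by
  have hfactor (ω : Ω) : Complex.exp (z * partialForm b τ ξ N ω) =
      ∏ i : Fin N, Complex.exp (z * (b i * (ξ i ω + τ i) ^ 2 : ℝ)) := by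
    rw [← Complex.exp_sum, partialForm, Finset.sum_range, Complex.ofReal_sum, Finset.mul_sum]
  simp_rw [complexMGF, hfactor]
  rw [(hind.precomp Fin.val_injective).integral_fun_prod_comp (𝕜 := ℂ)
    (X := fun i : Fin N => ξ i) (f := fun i v => Complex.exp (z * (b i * (v + τ i) ^ 2 : ℝ)))
    (fun i => (hξ i).aemeasurable) (fun i => Measurable.aestronglyMeasurable (by fun_prop)),
    Complex.exp_sum, Finset.prod_range]
  refine Finset.prod_congr rfl fun i _ => ?_
  rw [← integral_cexp_mul_sq_gaussianReal (hz i)]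
  exact (hξ i).integral_comp (f := fun v : ℝ => Complex.exp (z * (b i * (v + τ i) ^ 2 : ℝ)))
    (Measurable.aestronglyMeasurable (by fun_prop))

lemma integrable_exp_partialForm (hξ : ∀ j, HasLaw (ξ j) (gaussianReal 0 1) P)
    (hind : iIndepFun ξ P) (ht : ∀ j, 0 < (1 - 2 * (t : ℂ) * b j).re) (N : ℕ) :
    Integrable (fun ω => Real.exp (t * partialForm b τ ξ N ω)) P := by
  by_contra hcon
  have hmgf := complexMGF_partialForm (τ := τ) hξ hind ht N
  rw [complexMGF_ofReal, mgf, integral_undef hcon] at hmgf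
  exact Complex.exp_ne_zero _ hmgf.symm

namespace IsWeightSystem

lemma re_one_sub_two_mul_pos {d : ℕ → ℝ} (h : IsWeightSystem b d β) (hz : z.re * β ≤ 1 / 4)
    (j : ℕ) : 0 < (1 - 2 * z * b j).re :=
  one_half_pos.trans_le (half_le_re_one_sub_two_mul (h.mul_weight_le hz j))

lemma ae_summable_quadForm (h : IsWeightSystem b (fun j => b j * τ j ^ 2) β)
    (hξ : ∀ j, HasLaw (ξ j) (gaussianReal 0 1) P) :
    ∀ᵐ ω ∂P, Summable fun j => b j * (ξ j ω + τ j) ^ 2 := by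
  refine ae_summable_of_summable_integral (fun j => (integrable_add_sq (hξ j) (τ j)).const_mul _)
    (fun j ω => mul_nonneg (h.nonneg j) (sq_nonneg _)) ?_
  simp_rw [integral_const_mul, integral_add_sq (hξ _), mul_add, mul_one]
  exact h.summable.add h.summable_noncentrality

lemma ae_tendsto_partialForm (h : IsWeightSystem b (fun j => b j * τ j ^ 2) β)
    (hξ : ∀ j, HasLaw (ξ j) (gaussianReal 0 1) P) :
    ∀ᵐ ω ∂P, Tendsto (fun N => partialForm b τ ξ N ω) atTop (𝓝 (quadForm b τ ξ ω)) :=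
  (h.ae_summable_quadForm hξ).mono fun _ hω => hω.hasSum.tendsto_sum_nat

lemma ae_partialForm_le_quadForm (h : IsWeightSystem b (fun j => b j * τ j ^ 2) β)
    (hξ : ∀ j, HasLaw (ξ j) (gaussianReal 0 1) P) (N : ℕ) :
    ∀ᵐ ω ∂P, partialForm b τ ξ N ω ≤ quadForm b τ ξ ω :=
  (h.ae_summable_quadForm hξ).mono fun _ hω =>
    hω.sum_le_tsum _ fun j _ => mul_nonneg (h.nonneg j) (sq_nonneg _)

lemma aemeasurable_quadForm (h : IsWeightSystem b (fun j => b j * τ j ^ 2) β)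
    (hξ : ∀ j, HasLaw (ξ j) (gaussianReal 0 1) P) : AEMeasurable (quadForm b τ ξ) P :=
  aemeasurable_of_tendsto_metrizable_ae' (aemeasurable_partialForm hξ)
    (h.ae_tendsto_partialForm hξ)

lemma hasSum_squareTerm {d : ℕ → ℝ} (h : IsWeightSystem b d β) (hz : z.re * β ≤ 1 / 4) :
    HasSum (fun j => squareTerm (b j) (d j) z)
      (cumulant b d z + (z * (∑' j, b j : ℝ) + z * (∑' j, d j : ℝ))) := by
  have hb := (Complex.hasSum_ofReal.2 h.summable.hasSum).mul_left z
  have hd := (Complex.hasSum_ofReal.2 h.summable_noncentrality.hasSum).mul_left z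
  refine ((h.summable_cumulantTerm hz).hasSum.add (hb.add hd)).congr_fun fun j =>
    squareTerm_eq_cumulantTerm_add fun hzero => ?_
  simpa [hzero] using h.re_one_sub_two_mul_pos hz j

lemma tendsto_complexMGF_partialForm (h : IsWeightSystem b (fun j => b j * τ j ^ 2) β)
    (hξ : ∀ j, HasLaw (ξ j) (gaussianReal 0 1) P) (hind : iIndepFun ξ P)
    (hz : z.re * β ≤ 1 / 4) :
    Tendsto (fun N => complexMGF (partialForm b τ ξ N) P z) atTop
      (𝓝 (Complex.exp (cumulant b (fun j => b j * τ j ^ 2) z +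
        (z * (∑' j, b j : ℝ) + z * (∑' j, b j * τ j ^ 2 : ℝ))))) := by
  simp_rw [complexMGF_partialForm hξ hind (h.re_one_sub_two_mul_pos hz)]
  exact (Complex.continuous_exp.tendsto _).comp (h.hasSum_squareTerm hz).tendsto_sum_nat

lemma integrable_exp_quadForm (h : IsWeightSystem b (fun j => b j * τ j ^ 2) β)
    (hξ : ∀ j, HasLaw (ξ j) (gaussianReal 0 1) P) (hind : iIndepFun ξ P) (ht : t * β ≤ 1 / 4) :
    Integrable (fun ω => Real.exp (t * quadForm b τ ξ ω)) P := by
  have ht' : (t : ℂ).re * β ≤ 1 / 4 := by simpa using ht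
  refine integrable_of_tendsto_of_tendsto_integral
    (integrable_exp_partialForm hξ hind (h.re_one_sub_two_mul_pos ht'))
    (fun N ω => (Real.exp_pos _).le) ?_
    ((Complex.continuous_re.tendsto _).comp (h.tendsto_complexMGF_partialForm hξ hind ht') |>.congr
      fun N => by rw [Function.comp_apply, complexMGF_ofReal, Complex.ofReal_re, mgf])
  exact (h.ae_tendsto_partialForm hξ).mono fun ω hω =>
    (Real.continuous_exp.tendsto _).comp (hω.const_mul t)

lemma complexMGF_quadForm (h : IsWeightSystem b (fun j => b j * τ j ^ 2) β)
    (hξ : ∀ j, HasLaw (ξ j) (gaussianReal 0 1) P) (hind : iIndepFun ξ P)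
    (hz : z.re * β ≤ 1 / 4) :
    complexMGF (quadForm b τ ξ) P z =
      Complex.exp (cumulant b (fun j => b j * τ j ^ 2) z +
        (z * (∑' j, b j : ℝ) + z * (∑' j, b j * τ j ^ 2 : ℝ))) := by
  have hmax : max z.re 0 * β ≤ 1 / 4 := by
    rw [max_mul_of_nonneg _ _ h.bound_nonneg, zero_mul]
    exact max_le hz (by norm_num)
  refine tendsto_nhds_unique (tendsto_integral_of_dominated_convergence
    (fun ω => Real.exp (max z.re 0 * quadForm b τ ξ ω)) (fun N => ?_)
    (h.integrable_exp_quadForm hξ hind hmax) (fun N => ?_) ?_)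
    (h.tendsto_complexMGF_partialForm hξ hind hz)
  · have := aemeasurable_partialForm (b := b) (τ := τ) hξ N
    exact AEMeasurable.aestronglyMeasurable (by fun_prop)
  · filter_upwards [h.ae_partialForm_le_quadForm hξ N] with ω hω
    rw [Complex.norm_exp, Complex.re_mul_ofReal, Real.exp_le_exp]
    have hnonneg : 0 ≤ partialForm b τ ξ N ω :=
      Finset.sum_nonneg fun j _ => mul_nonneg (h.nonneg j) (sq_nonneg _)
    exact mul_le_mul (le_max_left _ _) hω hnonneg (le_max_right _ _)
  · filter_upwards [h.ae_tendsto_partialForm hξ] with ω hω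
    exact (Complex.continuous_exp.tendsto _).comp
      (((Complex.continuous_ofReal.tendsto _).comp hω).const_mul z)

lemma complexMGF_centredForm (h : IsWeightSystem b (fun j => b j * τ j ^ 2) β)
    (hξ : ∀ j, HasLaw (ξ j) (gaussianReal 0 1) P) (hind : iIndepFun ξ P)
    (hz : z.re * β ≤ 1 / 4) :
    complexMGF (centredForm b τ ξ) P z =
      Complex.exp (cumulant b (fun j => b j * τ j ^ 2) z) := by
  set s : ℂ := z * (∑' j, b j : ℝ) + z * (∑' j, b j * τ j ^ 2 : ℝ) with hs
  have hcentre (ω : Ω) : Complex.exp (z * centredForm b τ ξ ω) =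
      Complex.exp (z * quadForm b τ ξ ω) * Complex.exp (-s) := by
    rw [← Complex.exp_add, centredForm, hs]
    push_cast
    ring_nf
  simp_rw [complexMGF, hcentre, integral_mul_const]
  rw [← complexMGF, h.complexMGF_quadForm hξ hind hz, ← hs, ← Complex.exp_add,
    add_neg_cancel_right]

lemma integrable_exp_centredForm (h : IsWeightSystem b (fun j => b j * τ j ^ 2) β)
    (hξ : ∀ j, HasLaw (ξ j) (gaussianReal 0 1) P) (hind : iIndepFun ξ P) (ht : t * β ≤ 1 / 4) :
    Integrable (fun ω => Real.exp (t * centredForm b τ ξ ω)) P := by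
  simp_rw [centredForm, mul_sub, Real.exp_sub]
  exact (h.integrable_exp_quadForm hξ hind ht).div_const _

theorem nearGaussian_centredForm (h : IsWeightSystem b (fun j => b j * τ j ^ 2) β)
    (hξ : ∀ j, HasLaw (ξ j) (gaussianReal 0 1) P) (hind : iIndepFun ξ P) :
    NearGaussian P (centredForm b τ ξ) β (∑' j, b j * τ j ^ 2) where
  aemeasurable := (h.aemeasurable_quadForm hξ).sub_const _
  bound_nonneg := h.bound_nonneg
  integrable_exp t ht := h.integrable_exp_centredForm hξ hind
    ((mul_le_mul_of_nonneg_right (le_abs_self t) h.bound_nonneg).trans ht)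
  exists_cumulant := ⟨cumulant b fun j => b j * τ j ^ 2,
    fun _ hz => h.complexMGF_centredForm hξ hind
      ((mul_le_mul_of_nonneg_right (le_abs_self _) h.bound_nonneg).trans hz),
    fun _ hz => h.norm_cumulant_sub_le hz, fun hβ _ u ht => h.re_cumulant_le hβ ht u⟩

end IsWeightSystem

end QuadForm

section Positivity

lemma mul_sub_div_le_re_cumulantTerm_neg {b s : ℝ} (d : ℝ) (hb : 0 ≤ b) (hs : 0 ≤ s) :
    s * (d - d / (1 + 2 * s * b)) ≤ (cumulantTerm b d ((-s : ℝ) : ℂ)).re := by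
  have hpos : 0 < 1 + 2 * s * b := by positivity
  have hden : 1 - 2 * -s * b = 1 + 2 * s * b := by ring
  have hlog := Real.log_le_sub_one_of_pos hpos
  have hnoncentral : 2 * (-s) ^ 2 * b * d / (1 + 2 * s * b) = s * (d - d / (1 + 2 * s * b)) := by
    field_simp
    ring
  rw [re_cumulantTerm_ofReal (by linarith), hden, hnoncentral]
  linarith

namespace IsWeightSystem

variable {b d : ℕ → ℝ} {β s : ℝ}

lemma div_one_add_le (h : IsWeightSystem b d β) (hs : 0 ≤ s) (j : ℕ) :
    d j / (1 + 2 * s * b j) ≤ d j := by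
  have := h.nonneg j
  exact div_le_self (h.nonneg_noncentrality j) (le_add_of_nonneg_right (by positivity))

lemma div_one_add_nonneg (h : IsWeightSystem b d β) (hs : 0 ≤ s) (j : ℕ) :
    0 ≤ d j / (1 + 2 * s * b j) := by
  have := h.nonneg j
  exact div_nonneg (h.nonneg_noncentrality j) (by positivity)

lemma mul_sub_tsum_div_le_re_cumulant_neg (h : IsWeightSystem b d β) (hs : 0 ≤ s) :
    s * (∑' j, d j - ∑' j, d j / (1 + 2 * s * b j)) ≤ (cumulant b d ((-s : ℝ) : ℂ)).re := by
  have hdom : ((-s : ℝ) : ℂ).re * β ≤ 1 / 4 := by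
    rw [Complex.ofReal_re]
    nlinarith [h.bound_nonneg]
  have hdiv : Summable fun j => d j / (1 + 2 * s * b j) :=
    .of_nonneg_of_le (h.div_one_add_nonneg hs) (h.div_one_add_le hs) h.summable_noncentrality
  exact hasSum_le (fun j => mul_sub_div_le_re_cumulantTerm_neg (d j) (h.nonneg j) hs)
    ((h.summable_noncentrality.hasSum.sub hdiv.hasSum).mul_left s)
    (Complex.hasSum_re (h.summable_cumulantTerm hdom).hasSum)

lemma tendsto_tsum_div_one_add (h : IsWeightSystem b (fun j => b j * d j) β) :
    Tendsto (fun s : ℝ => ∑' j, b j * d j / (1 + 2 * s * b j)) atTop (𝓝 0) := by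
  suffices h0 : Tendsto (fun s : ℝ => ∑' j, b j * d j / (1 + 2 * s * b j)) atTop
      (𝓝 (∑' _ : ℕ, 0)) by rwa [tsum_zero] at h0
  refine tendsto_tsum_of_dominated_convergence h.summable_noncentrality (fun j => ?_) ?_
  · rcases (h.nonneg j).eq_or_lt with hzero | hpos
    · simp [← hzero]
    · exact tendsto_const_nhds.div_atTop (tendsto_atTop_add_const_left _ _
        ((tendsto_id.const_mul_atTop two_pos).atTop_mul_const hpos))
  · filter_upwards [eventually_ge_atTop 0] with s hs j
    rw [Real.norm_of_nonneg (h.div_one_add_nonneg hs j)]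
    exact h.div_one_add_le hs j

end IsWeightSystem

variable {Ω : Type*} [MeasurableSpace Ω] {P : Measure Ω}

lemma mgf_neg_le_exp_of_ae_le [IsProbabilityMeasure P] {X : Ω → ℝ} {c s : ℝ} (hs : 0 ≤ s)
    (hX : ∀ᵐ ω ∂P, c ≤ X ω) : mgf X P (-s) ≤ Real.exp (-s * c) := by
  have hmono : mgf X P (-s) ≤ ∫ _, Real.exp (-s * c) ∂P :=
    integral_mono_of_nonneg (ae_of_all _ fun ω => (Real.exp_pos _).le) (integrable_const _)
      (hX.mono fun ω hω => Real.exp_le_exp.2 (mul_le_mul_of_nonpos_left hω (neg_nonpos.2 hs)))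
  simpa using hmono

variable {b τ : ℕ → ℝ} {ξ : ℕ → Ω → ℝ} {β x : ℝ}

lemma IsWeightSystem.le_tsum_div_of_ae_le (h : IsWeightSystem b (fun j => b j * τ j ^ 2) β)
    (hξ : ∀ j, HasLaw (ξ j) (gaussianReal 0 1) P) (hind : iIndepFun ξ P)
    (hx : ∀ᵐ ω ∂P, x - ∑' j, b j * τ j ^ 2 ≤ centredForm b τ ξ ω) {s : ℝ} (hs : 0 < s) :
    x ≤ ∑' j, b j * τ j ^ 2 / (1 + 2 * s * b j) := by
  have := (hξ 0).isProbabilityMeasure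
  have hdom : ((-s : ℝ) : ℂ).re * β ≤ 1 / 4 := by
    rw [Complex.ofReal_re]
    nlinarith [h.bound_nonneg]
  have hmgf : mgf (centredForm b τ ξ) P (-s) =
      Real.exp (cumulant b (fun j => b j * τ j ^ 2) ((-s : ℝ) : ℂ)).re := by
    rw [← Complex.norm_exp, ← h.complexMGF_centredForm hξ hind hdom, complexMGF_ofReal,
      Complex.norm_real, Real.norm_of_nonneg mgf_nonneg]
  have hupper := mgf_neg_le_exp_of_ae_le hs.le hx
  rw [hmgf, Real.exp_le_exp] at hupper
  have hlower := h.mul_sub_tsum_div_le_re_cumulant_neg hs.le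
  refine le_of_mul_le_mul_left ?_ hs
  linarith

/-- If the form stayed above `x` almost surely, its Laplace transform at `-s` would be at most
`exp (-s x)`, whereas `-log` of that transform is `o(s)`. -/
theorem IsWeightSystem.measureReal_centredForm_le_pos
    (h : IsWeightSystem b (fun j => b j * τ j ^ 2) β)
    (hξ : ∀ j, HasLaw (ξ j) (gaussianReal 0 1) P) (hind : iIndepFun ξ P) (hx : 0 < x) :
    0 < P.real {ω | centredForm b τ ξ ω ≤ x - ∑' j, b j * τ j ^ 2} := by
  have := (hξ 0).isProbabilityMeasure
  refine measureReal_nonneg.lt_of_ne fun hzero => ?_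
  have hnull : P {ω | centredForm b τ ξ ω ≤ x - ∑' j, b j * τ j ^ 2} = 0 :=
    (measureReal_eq_zero_iff (measure_ne_top _ _)).1 hzero.symm
  have hae : ∀ᵐ ω ∂P, x - ∑' j, b j * τ j ^ 2 ≤ centredForm b τ ξ ω := by
    filter_upwards [measure_eq_zero_iff_ae_notMem.1 hnull] with ω hω using (not_le.1 hω).le
  have hlimit : x ≤ 0 := ge_of_tendsto h.tendsto_tsum_div_one_add
    ((eventually_gt_atTop 0).mono fun s hs => h.le_tsum_div_of_ae_le hξ hind hae hs)
  exact hlimit.not_gt hx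

end Positivity

section WhiteNoise

variable {Ω : Type*} [MeasurableSpace Ω] {P : Measure Ω} {W : Signal → Ω → ℝ} {φ : ℕ → Signal}

lemma IsGaussianWhiteNoise.hasLaw (hW : IsGaussianWhiteNoise W P)
    (hφ : Orthonormal ℝ fun j : ℕ => φ (j + 1)) (j : ℕ) :
    HasLaw (W (φ (j + 1))) (gaussianReal 0 1) P := by
  have hgauss := hW.isGaussianProcess.hasGaussianLaw_eval (φ (j + 1))
  have hvar : Var[W (φ (j + 1)); P] = 1 := by
    rw [← covariance_self hgauss.aemeasurable, hW.covariance_eq, real_inner_self_eq_norm_sq,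
      hφ.1 j, one_pow]
  refine ⟨hgauss.aemeasurable, ?_⟩
  rw [hgauss.map_eq_gaussianReal, hW.mean_eq_zero, hvar, Real.toNNReal_one]

lemma IsGaussianWhiteNoise.iIndepFun (hW : IsGaussianWhiteNoise W P)
    (hφ : Orthonormal ℝ fun j : ℕ => φ (j + 1)) : iIndepFun (fun j : ℕ => W (φ (j + 1))) P := by
  have hprocess : ProbabilityTheory.iIndepFun (fun (j : ℕ) ω (_ : Unit) => W (φ (j + 1)) ω) P :=
    IsGaussianProcess.iIndepFun_of_covariance_eq_zero
      (hW.isGaussianProcess.comp_right fun p : (_ : ℕ) × Unit => φ (p.1 + 1))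
      (fun _ _ => hW.isGaussianProcess.aemeasurable _)
      (fun i j hij _ _ => by rw [hW.covariance_eq]; exact hφ.2 hij)
  exact hprocess.comp (fun _ f => f ()) fun _ => measurable_pi_apply _

end WhiteNoise

section Coefficients

variable {κ : ℝ → ℕ → ℝ} {φ : ℕ → Signal} {ε : ℝ}

/-- The weights `ϰ_{εj}² ε⁻² (2 A_ε)^{-1/2}` of the standardized statistic as a quadratic form in
the normalized observations `y_{εj} / ε`; the index `j` stands for `j + 1` in the paper. -/
noncomputable def weight (κ : ℝ → ℕ → ℝ) (ε : ℝ) (j : ℕ) : ℝ :=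
  κ ε (j + 1) ^ 2 * ((ε ^ 2)⁻¹ * (√(2 * A κ ε))⁻¹)

/-- The mean `θ_j / ε` of the normalized observation `y_{εj} / ε`; the index `j` stands for
`j + 1` in the paper. -/
noncomputable def shift (φ : ℕ → Signal) (ε : ℝ) (S : Signal) (j : ℕ) : ℝ :=
  fourierCoeff φ S (j + 1) / ε

lemma weight_nonneg (j : ℕ) : 0 ≤ weight κ ε j := by
  unfold weight
  positivity

lemma weight_le_weight_zero (hκ : AntitoneOn (fun j => κ ε j ^ 2) (Set.Ici 1)) (j : ℕ) :
    weight κ ε j ≤ weight κ ε 0 :=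
  mul_le_mul_of_nonneg_right (hκ (by simp) (by simp) (by lia)) (by positivity)

lemma ne_zero_of_A_pos (hA : 0 < A κ ε) : ε ≠ 0 := by
  rintro rfl
  simp [A] at hA

lemma tsum_pow_four_pos (hA : 0 < A κ ε) : 0 < ∑' j, κ ε (j + 1) ^ 4 :=
  pos_of_mul_pos_right hA (by positivity)

lemma summable_pow_four (hA : 0 < A κ ε) : Summable fun j => κ ε (j + 1) ^ 4 := by
  by_contra hcon
  exact (tsum_pow_four_pos hA).ne' (tsum_eq_zero_of_not_summable hcon)

lemma weight_sq (hA : 0 < A κ ε) (j : ℕ) :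
    weight κ ε j ^ 2 = (ε ^ 4)⁻¹ * κ ε (j + 1) ^ 4 / (2 * A κ ε) := by
  rw [weight, mul_pow, mul_pow, inv_pow, inv_pow, Real.sq_sqrt (by positivity)]
  ring

lemma hasSum_weight_sq (hA : 0 < A κ ε) : HasSum (fun j => weight κ ε j ^ 2) (1 / 2) := by
  simp_rw [weight_sq hA]
  have hsum := ((summable_pow_four hA).hasSum.mul_left (ε ^ 4)⁻¹).div_const (2 * A κ ε)
  have hhalf : A κ ε / (2 * A κ ε) = 1 / 2 := by field_simp
  rwa [← A, hhalf] at hsum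

lemma summable_shift_sq (hφ : Orthonormal ℝ fun j : ℕ => φ (j + 1)) (S : Signal) :
    Summable fun j => shift φ ε S j ^ 2 := by
  refine ((hφ.inner_products_summable (x := S)).div_const (ε ^ 2)).congr fun j => ?_
  rw [shift, div_pow, fourierCoeff, Real.norm_eq_abs, sq_abs]

lemma isWeightSystem_weight (hφ : Orthonormal ℝ fun j : ℕ => φ (j + 1))
    (hκ_sum : Summable fun j => κ ε (j + 1) ^ 2)
    (hκ_anti : AntitoneOn (fun j => κ ε j ^ 2) (Set.Ici 1)) (hA : 0 < A κ ε) (S : Signal) :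
    IsWeightSystem (weight κ ε) (fun j => weight κ ε j * shift φ ε S j ^ 2) (weight κ ε 0) where
  nonneg := weight_nonneg
  le_bound := weight_le_weight_zero hκ_anti
  nonneg_noncentrality j := mul_nonneg (weight_nonneg j) (sq_nonneg _)
  summable := hκ_sum.mul_right _
  summable_noncentrality := .of_nonneg_of_le
    (fun j => mul_nonneg (weight_nonneg j) (sq_nonneg _))
    (fun j => mul_le_mul_of_nonneg_right (weight_le_weight_zero hκ_anti j) (sq_nonneg _))
    ((summable_shift_sq hφ S).mul_left _)
  hasSum_sq := hasSum_weight_sq hA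

lemma tsum_weight_mul_shift_sq (S : Signal) :
    ∑' j, weight κ ε j * shift φ ε S j ^ 2 = B φ κ ε S := by
  rw [B, D, ← tsum_mul_left, ← tsum_div_const]
  refine tsum_congr fun j => ?_
  rw [weight, shift]
  ring

lemma tsum_weight : ∑' j, weight κ ε j = (ε ^ 2)⁻¹ * (√(2 * A κ ε))⁻¹ * rhoSq κ ε := by
  simp_rw [weight, tsum_mul_right, rhoSq, mul_comm]

@[simp]
lemma B_zero : B φ κ ε 0 = 0 := by
  simp [B, D, fourierCoeff]

lemma B_nonneg (S : Signal) : 0 ≤ B φ κ ε S := by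
  rw [← tsum_weight_mul_shift_sq]
  exact tsum_nonneg fun j => mul_nonneg (weight_nonneg j) (sq_nonneg _)

lemma kIndex_mul_kappaSq_sq_le (hκ : AntitoneOn (fun j => κ ε j ^ 2) (Set.Ici 1))
    (hA : 0 < A κ ε) : kIndex κ ε * kappaSq κ ε ^ 2 ≤ ∑' j, κ ε (j + 1) ^ 4 := by
  have hterm : ∀ j ∈ Finset.range (kIndex κ ε), kappaSq κ ε ^ 2 ≤ κ ε (j + 1) ^ 4 := by
    intro j hj
    have hjk := Finset.mem_range.1 hj
    have hle : kappaSq κ ε ≤ κ ε (j + 1) ^ 2 :=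
      hκ (Set.mem_Ici.2 (by lia)) (Set.mem_Ici.2 (by lia)) (by lia)
    calc kappaSq κ ε ^ 2 ≤ (κ ε (j + 1) ^ 2) ^ 2 := pow_le_pow_left₀ (sq_nonneg _) hle 2
      _ = κ ε (j + 1) ^ 4 := by ring
  calc kIndex κ ε * kappaSq κ ε ^ 2 ≤ ∑ j ∈ Finset.range (kIndex κ ε), κ ε (j + 1) ^ 4 := by
        simpa using Finset.card_nsmul_le_sum _ _ _ hterm
    _ ≤ ∑' j, κ ε (j + 1) ^ 4 := (summable_pow_four hA).sum_le_tsum _ fun j _ => by positivity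

lemma weight_zero_mul_sqrt_kIndex_le {c : ℝ}
    (hκ : AntitoneOn (fun j => κ ε j ^ 2) (Set.Ici 1)) (hA : 0 < A κ ε) (hc : 0 ≤ c)
    (hle : κ ε 1 ^ 2 ≤ c * kappaSq κ ε) : weight κ ε 0 * √(kIndex κ ε) ≤ c := by
  have hε := ne_zero_of_A_pos hA
  have hsum_pos := tsum_pow_four_pos hA
  have hweight : weight κ ε 0 ^ 2 = κ ε 1 ^ 4 / (2 * ∑' j, κ ε (j + 1) ^ 4) := by
    rw [weight_sq hA, zero_add, A]
    field_simp
  have hpow : κ ε 1 ^ 4 ≤ c ^ 2 * kappaSq κ ε ^ 2 := by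
    calc κ ε 1 ^ 4 = (κ ε 1 ^ 2) ^ 2 := by ring
      _ ≤ (c * kappaSq κ ε) ^ 2 := by gcongr
      _ = c ^ 2 * kappaSq κ ε ^ 2 := mul_pow _ _ 2
  refine le_of_sq_le_sq ?_ hc
  rw [mul_pow, Real.sq_sqrt (Nat.cast_nonneg _), hweight, div_mul_eq_mul_div,
    div_le_iff₀ (by positivity)]
  calc κ ε 1 ^ 4 * kIndex κ ε ≤ c ^ 2 * kappaSq κ ε ^ 2 * kIndex κ ε := by gcongr
    _ = c ^ 2 * (kIndex κ ε * kappaSq κ ε ^ 2) := by ring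
    _ ≤ c ^ 2 * ∑' j, κ ε (j + 1) ^ 4 := by
        gcongr
        exact kIndex_mul_kappaSq_sq_le hκ hA
    _ ≤ c ^ 2 * (2 * ∑' j, κ ε (j + 1) ^ 4) := by
        gcongr
        linarith

end Coefficients

section ErrorProbabilities

variable {Ω : Type*} {W : Signal → Ω → ℝ} {φ : ℕ → Signal} {κ : ℝ → ℕ → ℝ} {ε x : ℝ} {S : Signal}

/-- The standardized statistic `ε⁻² (2 A_ε)^{-1/2} T_ε` under the signal `S`, centred at its
mean `B_ε(S)`. -/
noncomputable def centredStatistic (W : Signal → Ω → ℝ) (φ : ℕ → Signal) (κ : ℝ → ℕ → ℝ)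
    (ε : ℝ) (S : Signal) : Ω → ℝ :=
  centredForm (weight κ ε) (shift φ ε S) fun j => W (φ (j + 1))

lemma standardized_statistic_eq (hε : ε ≠ 0) (S : Signal) (ω : Ω) :
    (ε ^ 2)⁻¹ * (√(2 * A κ ε))⁻¹ * statistic κ ε (observation W φ ε S ω) =
      centredStatistic W φ κ ε S ω + B φ κ ε S := by
  have hterm (j : ℕ) : weight κ ε j * (W (φ (j + 1)) ω + shift φ ε S j) ^ 2 =
      (ε ^ 2)⁻¹ * (√(2 * A κ ε))⁻¹ * (ε ^ 2)⁻¹ *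
        (κ ε (j + 1) ^ 2 * observation W φ ε S ω (j + 1) ^ 2) := by
    rw [observation, weight, shift]
    field_simp
    ring
  rw [centredStatistic, centredForm, quadForm, tsum_weight, tsum_weight_mul_shift_sq, statistic]
  simp_rw [hterm, tsum_mul_left]
  ring

lemma test_observation_eq_indicator (hε : ε ≠ 0) :
    (fun ω => test κ ε x (observation W φ ε S ω)) =
      Set.indicator {ω | x - B φ κ ε S < centredStatistic W φ κ ε S ω} fun _ => 1 := by
  ext ω
  simp only [test, Set.indicator_apply, Set.mem_ofPred_eq, standardized_statistic_eq hε,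
    sub_lt_iff_lt_add]

variable [MeasurableSpace Ω] {P : Measure Ω}

lemma nearGaussian_centredStatistic (hW : IsGaussianWhiteNoise W P)
    (hφ : Orthonormal ℝ fun j : ℕ => φ (j + 1)) (hκ_sum : Summable fun j => κ ε (j + 1) ^ 2)
    (hκ_anti : AntitoneOn (fun j => κ ε j ^ 2) (Set.Ici 1)) (hA : 0 < A κ ε) (S : Signal) :
    NearGaussian P (centredStatistic W φ κ ε S) (weight κ ε 0) (B φ κ ε S) := by
  rw [← tsum_weight_mul_shift_sq]
  exact (isWeightSystem_weight hφ hκ_sum hκ_anti hA S).nearGaussian_centredForm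
    (hW.hasLaw hφ) (hW.iIndepFun hφ)

lemma integral_test (hm : AEMeasurable (centredStatistic W φ κ ε S) P) (hε : ε ≠ 0) (x : ℝ) :
    ∫ ω, test κ ε x (observation W φ ε S ω) ∂P =
      P.real {ω | x - B φ κ ε S < centredStatistic W φ κ ε S ω} := by
  rw [test_observation_eq_indicator hε,
    integral_indicator₀ (nullMeasurableSet_lt aemeasurable_const hm), setIntegral_const,
    smul_eq_mul, mul_one]

lemma typeI_eq (hm : AEMeasurable (centredStatistic W φ κ ε 0) P) (hε : ε ≠ 0) (x : ℝ) :
    typeI P W φ κ ε x = P.real {ω | x < centredStatistic W φ κ ε 0 ω} := by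
  rw [typeI, integral_test hm hε, B_zero, sub_zero]

variable [IsProbabilityMeasure P]

lemma integrable_test (hm : AEMeasurable (centredStatistic W φ κ ε S) P) (hε : ε ≠ 0) (x : ℝ) :
    Integrable (fun ω => test κ ε x (observation W φ ε S ω)) P := by
  rw [test_observation_eq_indicator hε]
  exact (integrable_const _).indicator₀ (nullMeasurableSet_lt aemeasurable_const hm)

lemma typeII_eq (hm : AEMeasurable (centredStatistic W φ κ ε S) P) (hε : ε ≠ 0) (x : ℝ) :
    typeII P W φ κ ε x S = P.real {ω | B φ κ ε S - x ≤ -centredStatistic W φ κ ε S ω} := by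
  have hcompl : {ω | B φ κ ε S - x ≤ -centredStatistic W φ κ ε S ω} =
      {ω | x - B φ κ ε S < centredStatistic W φ κ ε S ω}ᶜ := by
    ext ω
    rw [Set.mem_compl_iff, Set.mem_ofPred_eq, Set.mem_ofPred_eq, not_lt, le_neg, neg_sub]
  rw [typeII, integral_sub (integrable_const _) (integrable_test hm hε x), integral_test hm hε,
    hcompl, probReal_compl_eq_one_sub₀ (nullMeasurableSet_lt aemeasurable_const hm)]
  simp

lemma typeII_pos (hW : IsGaussianWhiteNoise W P) (hφ : Orthonormal ℝ fun j : ℕ => φ (j + 1))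
    (hκ_sum : Summable fun j => κ ε (j + 1) ^ 2)
    (hκ_anti : AntitoneOn (fun j => κ ε j ^ 2) (Set.Ici 1)) (hA : 0 < A κ ε) (hx : 0 < x) :
    0 < typeII P W φ κ ε x S := by
  have hpos := (isWeightSystem_weight hφ hκ_sum hκ_anti hA S).measureReal_centredForm_le_pos
    (hW.hasLaw hφ) (hW.iIndepFun hφ) hx
  rw [tsum_weight_mul_shift_sq] at hpos
  rw [typeII_eq (nearGaussian_centredStatistic hW hφ hκ_sum hκ_anti hA S).aemeasurable
    (ne_zero_of_A_pos hA)]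
  simp_rw [le_neg, neg_sub]
  exact hpos

end ErrorProbabilities

section SignalSize

variable {φ : ℕ → Signal} {κ : ℝ → ℕ → ℝ}

lemma AssumptionA2.A_pos (hA2 : AssumptionA2 κ) {ε : ℝ} (hε : 0 < ε) : 0 < A κ ε := by
  obtain ⟨C₁, C₂, hC₁, hbounds⟩ := hA2
  exact hC₁.trans (hbounds ε hε).1

lemma AssumptionA2.tendsto_B (hA2 : AssumptionA2 κ) {S : ℝ → Signal}
    (hD : Tendsto (fun ε => D φ κ ε (S ε)) (𝓝[>] 0) atTop) :
    Tendsto (fun ε => B φ κ ε (S ε)) (𝓝[>] 0) atTop := by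
  have hpos := hA2.A_pos one_pos
  obtain ⟨C₁, C₂, hC₁, hbounds⟩ := hA2
  have hC₂ : 0 < C₂ := hpos.trans (hbounds 1 one_pos).2
  refine tendsto_atTop_mono' _ ?_ (hD.atTop_div_const (show 0 < √(2 * C₂) by positivity))
  filter_upwards [eventually_mem_nhdsWithin, hD.eventually_ge_atTop 0] with ε hε hDε
  have hA := hC₁.trans (hbounds ε hε).1
  have hle := (hbounds ε hε).2
  rw [B]
  gcongr

lemma AssumptionA2.isBigO_B (hA2 : AssumptionA2 κ) (S : ℝ → Signal) :
    (fun ε => B φ κ ε (S ε)) =O[𝓝[>] 0] fun ε => D φ κ ε (S ε) := by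
  obtain ⟨C₁, C₂, hC₁, hbounds⟩ := hA2
  refine .of_bound (√(2 * C₁))⁻¹ ?_
  filter_upwards [eventually_mem_nhdsWithin] with ε hε
  have hle := (hbounds ε hε).1
  rw [B, norm_div, Real.norm_of_nonneg (Real.sqrt_nonneg _), div_eq_inv_mul]
  gcongr

lemma tendsto_atTop_of_orderLE {f g : ℝ → ℝ} (hf : Tendsto f (𝓝[>] 0) atTop)
    (hfg : OrderLE f g) : Tendsto g (𝓝[>] 0) atTop := by
  obtain ⟨C, hC, hle⟩ := hfg
  refine tendsto_atTop_mono' _ (hle.mono fun ε hε => ?_) (hf.atTop_div_const hC)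
  rwa [div_le_iff₀' hC]

lemma tendsto_weight_zero_of_mul_le {f : ℝ → ℝ} (hf : Tendsto f (𝓝[>] 0) atTop) {C : ℝ}
    (hle : ∀ᶠ ε in 𝓝[>] 0, weight κ ε 0 * f ε ≤ C) :
    Tendsto (fun ε => weight κ ε 0) (𝓝[>] 0) (𝓝 0) := by
  refine squeeze_zero' (.of_forall fun _ => weight_nonneg 0) ?_ (hf.const_div_atTop C)
  filter_upwards [hle, hf.eventually_gt_atTop 0] with ε hε hpos
  rwa [le_div_iff₀ hpos]

lemma isLittleO_pow_three_of_isLittleO_rpow {f : ℝ → ℝ}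
    (hf : f =o[𝓝[>] 0] fun ε => (kIndex κ ε : ℝ) ^ (1 / 6 : ℝ)) :
    (fun ε => f ε ^ 3) =o[𝓝[>] 0] fun ε => (kIndex κ ε : ℝ) ^ (1 / 2 : ℝ) := by
  refine (hf.pow three_pos).congr_right fun ε => ?_
  rw [← Real.rpow_natCast, ← Real.rpow_mul (Nat.cast_nonneg _)]
  norm_num

end SignalSize

lemma measureReal_lt_le_measureReal_le {Ω : Type*} [MeasurableSpace Ω] (P : Measure Ω)
    [IsFiniteMeasure P] (X : Ω → ℝ) (y : ℝ) :
    P.real {ω | y < X ω} ≤ P.real {ω | y ≤ X ω} :=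
  measureReal_mono fun _ (hω : y < _) => hω.le

/-- The conditions on the coefficients behind the error asymptotics: finite `ρ_ε²`, the assumptions
A1 and A2, and the bound `ϰ_{ε1}² = O(ϰ_ε²)`, which makes the largest weight of the standardized
statistic of order `k_ε^{-1/2}`. -/
structure IsRegularFamily (κ : ℝ → ℕ → ℝ) : Prop where
  summable_sq : ∀ ε > 0, Summable fun j : ℕ => κ ε (j + 1) ^ 2
  antitoneOn_sq : AssumptionA1 κ
  A_bounds : AssumptionA2 κ
  isBigO_kappaSq : (fun ε => κ ε 1 ^ 2) =O[𝓝[>] 0] fun ε => kappaSq κ ε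

namespace IsRegularFamily

variable {κ : ℝ → ℕ → ℝ}

lemma exists_weight_zero_mul_le (hκ : IsRegularFamily κ) :
    ∃ C > 0, ∀ᶠ ε in 𝓝[>] 0, weight κ ε 0 * (kIndex κ ε : ℝ) ^ (1 / 2 : ℝ) ≤ C := by
  obtain ⟨C, hC, hbound⟩ := hκ.isBigO_kappaSq.exists_pos
  refine ⟨C, hC, ?_⟩
  filter_upwards [hbound.bound, eventually_mem_nhdsWithin] with ε hle hε
  have hκ_nonneg : 0 ≤ kappaSq κ ε := sq_nonneg _
  rw [Real.norm_of_nonneg (sq_nonneg _), Real.norm_of_nonneg hκ_nonneg] at hle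
  rw [← Real.sqrt_eq_rpow]
  exact weight_zero_mul_sqrt_kIndex_le (hκ.antitoneOn_sq ε hε) (hκ.A_bounds.A_pos hε) hC.le hle

lemma tendsto_weight_zero_mul (hκ : IsRegularFamily κ) {f : ℝ → ℝ}
    (hf : f =o[𝓝[>] 0] fun ε => (kIndex κ ε : ℝ) ^ (1 / 2 : ℝ)) :
    Tendsto (fun ε => weight κ ε 0 * f ε) (𝓝[>] 0) (𝓝 0) := by
  obtain ⟨C, -, hle⟩ := hκ.exists_weight_zero_mul_le
  have hbounded : (fun ε => weight κ ε 0 * (kIndex κ ε : ℝ) ^ (1 / 2 : ℝ)) =O[𝓝[>] 0]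
      fun _ => (1 : ℝ) := by
    refine .of_bound C (hle.mono fun ε hε => ?_)
    rwa [Real.norm_of_nonneg (mul_nonneg (weight_nonneg 0) (by positivity)), norm_one, mul_one]
  exact (isLittleO_one_iff ℝ).1 (((isBigO_refl _ _).mul_isLittleO hf).trans_isBigO hbounded)

variable {Ω : Type*} [MeasurableSpace Ω] {P : Measure Ω} {W : Signal → Ω → ℝ} {φ : ℕ → Signal}

lemma nearGaussian (hκ : IsRegularFamily κ) (hW : IsGaussianWhiteNoise W P)
    (hφ : Orthonormal ℝ fun j : ℕ => φ (j + 1)) {ε : ℝ} (hε : 0 < ε) (S : Signal) :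
    NearGaussian P (centredStatistic W φ κ ε S) (weight κ ε 0) (B φ κ ε S) :=
  nearGaussian_centredStatistic hW hφ (hκ.summable_sq ε hε) (hκ.antitoneOn_sq ε hε)
    (hκ.A_bounds.A_pos hε) S

lemma eventually_nearGaussian (hκ : IsRegularFamily κ) (hW : IsGaussianWhiteNoise W P)
    (hφ : Orthonormal ℝ fun j : ℕ => φ (j + 1)) (S : ℝ → Signal) :
    ∀ᶠ ε in 𝓝[>] 0, NearGaussian P (centredStatistic W φ κ ε (S ε)) (weight κ ε 0)
      (B φ κ ε (S ε)) :=
  eventually_mem_nhdsWithin.mono fun _ hε => hκ.nearGaussian hW hφ hε _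

lemma eventually_nearGaussian_zero (hκ : IsRegularFamily κ) (hW : IsGaussianWhiteNoise W P)
    (hφ : Orthonormal ℝ fun j : ℕ => φ (j + 1)) :
    ∀ᶠ ε in 𝓝[>] 0, NearGaussian P (centredStatistic W φ κ ε 0) (weight κ ε 0) 0 := by
  simpa only [B_zero] using hκ.eventually_nearGaussian hW hφ fun _ => 0

lemma eventually_typeI_eq (hκ : IsRegularFamily κ) (hW : IsGaussianWhiteNoise W P)
    (hφ : Orthonormal ℝ fun j : ℕ => φ (j + 1)) (x : ℝ → ℝ) :
    ∀ᶠ ε in 𝓝[>] 0, typeI P W φ κ ε (x ε) =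
      P.real {ω | x ε < centredStatistic W φ κ ε 0 ω} :=
  eventually_mem_nhdsWithin.mono fun _ hε =>
    typeI_eq (hκ.nearGaussian hW hφ hε 0).aemeasurable (ne_of_gt hε) _

variable [IsProbabilityMeasure P]

lemma eventually_typeII_eq (hκ : IsRegularFamily κ) (hW : IsGaussianWhiteNoise W P)
    (hφ : Orthonormal ℝ fun j : ℕ => φ (j + 1)) (x : ℝ → ℝ) (S : ℝ → Signal) :
    ∀ᶠ ε in 𝓝[>] 0, typeII P W φ κ ε (x ε) (S ε) =
      P.real {ω | B φ κ ε (S ε) - x ε ≤ -centredStatistic W φ κ ε (S ε) ω} :=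
  eventually_mem_nhdsWithin.mono fun _ hε =>
    typeII_eq (hκ.nearGaussian hW hφ hε _).aemeasurable (ne_of_gt hε) _

lemma eventually_typeII_pos (hκ : IsRegularFamily κ) (hW : IsGaussianWhiteNoise W P)
    (hφ : Orthonormal ℝ fun j : ℕ => φ (j + 1)) {x : ℝ → ℝ} (hx : ∀ᶠ ε in 𝓝[>] 0, 0 < x ε)
    (S : ℝ → Signal) : ∀ᶠ ε in 𝓝[>] 0, 0 < typeII P W φ κ ε (x ε) (S ε) := by
  filter_upwards [eventually_mem_nhdsWithin, hx] with ε hε hxε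
  exact typeII_pos hW hφ (hκ.summable_sq ε hε) (hκ.antitoneOn_sq ε hε) (hκ.A_bounds.A_pos hε) hxε

/-- The null statistic exceeds zero with probability bounded away from zero. -/
lemma eventually_threshold_pos (hκ : IsRegularFamily κ) (hW : IsGaussianWhiteNoise W P)
    (hφ : Orthonormal ℝ fun j : ℕ => φ (j + 1))
    (hweight : Tendsto (fun ε => weight κ ε 0) (𝓝[>] 0) (𝓝 0)) {x : ℝ → ℝ}
    (hα : Tendsto (fun ε => typeI P W φ κ ε (x ε)) (𝓝[>] 0) (𝓝 0)) :
    ∀ᶠ ε in 𝓝[>] 0, 0 < x ε := by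
  obtain ⟨c, hc, hle⟩ := exists_pos_le_measureReal_pos (hκ.eventually_nearGaussian_zero hW hφ)
    hweight (by simp)
  filter_upwards [hle, hα.eventually_lt_const hc, hκ.eventually_typeI_eq hW hφ x]
    with ε hle_ε hlt heq
  by_contra! hx
  have hmono : P.real {ω | 0 < centredStatistic W φ κ ε 0 ω} ≤ typeI P W φ κ ε (x ε) :=
    heq ▸ measureReal_mono fun ω hω => hx.trans_lt hω
  exact (hle_ε.trans hmono).not_gt hlt

lemma eventually_sub_le (hκ : IsRegularFamily κ) (hW : IsGaussianWhiteNoise W P)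
    (hφ : Orthonormal ℝ fun j : ℕ => φ (j + 1))
    (hweight : Tendsto (fun ε => weight κ ε 0) (𝓝[>] 0) (𝓝 0)) {x : ℝ → ℝ}
    (hα : Tendsto (fun ε => typeI P W φ κ ε (x ε)) (𝓝[>] 0) (𝓝 0)) (S : ℝ → Signal) :
    ∀ᶠ ε in 𝓝[>] 0, B φ κ ε (S ε) - x ε ≤ B φ κ ε (S ε) :=
  (hκ.eventually_threshold_pos hW hφ hweight hα).mono fun _ hx => sub_le_self _ hx.le

theorem isEquivalent_typeI (hκ : IsRegularFamily κ) (hW : IsGaussianWhiteNoise W P)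
    (hφ : Orthonormal ℝ fun j : ℕ => φ (j + 1)) {x : ℝ → ℝ} (hx : Tendsto x (𝓝[>] 0) atTop)
    (hxk : x =o[𝓝[>] 0] fun ε => (kIndex κ ε : ℝ) ^ (1 / 6 : ℝ)) :
    (fun ε => typeI P W φ κ ε (x ε)) ~[𝓝[>] 0] fun ε => 1 - Phi (x ε) := by
  have heq := hκ.eventually_typeI_eq hW hφ x
  simp only [one_sub_Phi]
  exact isEquivalent_tail (hκ.eventually_nearGaussian_zero hW hφ) (hx.eventually_ge_atTop 1)
    (hκ.tendsto_weight_zero_mul (isLittleO_pow_three_of_isLittleO_rpow hxk))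
    (.of_forall fun _ => le_rfl) (by simp) (heq.mono fun _ h => h.ge)
    (heq.mono fun _ h => h.trans_le (measureReal_lt_le_measureReal_le P _ _))

theorem isEquivalent_sqrt_log_typeI (hκ : IsRegularFamily κ) (hW : IsGaussianWhiteNoise W P)
    (hφ : Orthonormal ℝ fun j : ℕ => φ (j + 1)) {x : ℝ → ℝ} (hx : Tendsto x (𝓝[>] 0) atTop)
    (hxk : x =o[𝓝[>] 0] fun ε => (kIndex κ ε : ℝ) ^ (1 / 2 : ℝ)) :
    (fun ε => √(2 * |Real.log (typeI P W φ κ ε (x ε))|)) ~[𝓝[>] 0] x ∧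
      Tendsto (fun ε => typeI P W φ κ ε (x ε)) (𝓝[>] 0) (𝓝 0) := by
  have hX := hκ.eventually_nearGaussian_zero hW hφ
  have heq := hκ.eventually_typeI_eq hW hφ x
  have hweight := hκ.tendsto_weight_zero_mul hxk
  have hlog := tendsto_log_tail_div_sq hX hx hweight (by simp) (heq.mono fun _ h => h.ge)
    (heq.mono fun _ h => h.trans_le (measureReal_lt_le_measureReal_le P _ _))
  have hpos : ∀ᶠ ε in 𝓝[>] 0, 0 < typeI P W φ κ ε (x ε) := by
    filter_upwards [heq, eventually_measureReal_lt_pos hX hx hweight (by simp)] with ε h hpos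
    rwa [h]
  exact ⟨isEquivalent_sqrt_abs_log hx hlog, tendsto_zero_of_tendsto_log_div_sq hx hpos hlog⟩

theorem isEquivalent_typeII (hκ : IsRegularFamily κ) (hW : IsGaussianWhiteNoise W P)
    (hφ : Orthonormal ℝ fun j : ℕ => φ (j + 1)) {x : ℝ → ℝ} {S : ℝ → Signal}
    (hα : Tendsto (fun ε => typeI P W φ κ ε (x ε)) (𝓝[>] 0) (𝓝 0))
    (hD : Tendsto (fun ε => D φ κ ε (S ε)) (𝓝[>] 0) atTop)
    (hDk : (fun ε => D φ κ ε (S ε)) =o[𝓝[>] 0] fun ε => (kIndex κ ε : ℝ) ^ (1 / 6 : ℝ))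
    (hBx : OrderLE (fun ε => B φ κ ε (S ε)) fun ε => B φ κ ε (S ε) - x ε) :
    (fun ε => typeII P W φ κ ε (x ε) (S ε)) ~[𝓝[>] 0] fun ε => Phi (x ε - B φ κ ε (S ε)) := by
  have hB := hκ.A_bounds.tendsto_B hD
  have hy := tendsto_atTop_of_orderLE hB hBx
  have hB_cube := hκ.tendsto_weight_zero_mul
    (isLittleO_pow_three_of_isLittleO_rpow ((hκ.A_bounds.isBigO_B S).trans_isLittleO hDk))
  have hweight := tendsto_weight_zero_of_mul_le ((tendsto_pow_atTop three_ne_zero).comp hB)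
    (hB_cube.eventually_le_const one_pos)
  have hy_le := hκ.eventually_sub_le hW hφ hweight hα S
  have hy_cube : Tendsto (fun ε => weight κ ε 0 * (B φ κ ε (S ε) - x ε) ^ 3) (𝓝[>] 0) (𝓝 0) := by
    refine squeeze_zero' ?_ ?_ hB_cube <;>
      filter_upwards [hy.eventually_ge_atTop 0, hy_le] with ε hnonneg hle <;>
      have := weight_nonneg (κ := κ) (ε := ε) 0
    · positivity
    · gcongr
  have hy_sq_mul : Tendsto (fun ε => weight κ ε 0 * (B φ κ ε (S ε) - x ε) ^ 2 * B φ κ ε (S ε))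
      (𝓝[>] 0) (𝓝 0) := by
    refine squeeze_zero' ?_ ?_ hB_cube <;>
      filter_upwards [hy.eventually_ge_atTop 0, hy_le] with ε hnonneg hle <;>
      have := weight_nonneg (κ := κ) (ε := ε) 0 <;>
      have := hnonneg.trans hle
    · positivity
    · rw [pow_succ (B φ κ ε (S ε)) 2, ← mul_assoc]
      gcongr
  have heq := hκ.eventually_typeII_eq hW hφ x S
  simp only [← neg_sub (B _ _ _ _) (x _), Phi_neg]
  exact isEquivalent_tail ((hκ.eventually_nearGaussian hW hφ S).mono fun _ h => h.neg)
    (hy.eventually_ge_atTop 1) hy_cube (.of_forall fun _ => B_nonneg _) hy_sq_mul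
    (heq.mono fun _ h => (measureReal_lt_le_measureReal_le P _ _).trans_eq h.symm)
    (heq.mono fun _ h => h.le)

theorem isEquivalent_sqrt_log_typeII (hκ : IsRegularFamily κ) (hW : IsGaussianWhiteNoise W P)
    (hφ : Orthonormal ℝ fun j : ℕ => φ (j + 1)) {x : ℝ → ℝ} {S : ℝ → Signal}
    (hα : Tendsto (fun ε => typeI P W φ κ ε (x ε)) (𝓝[>] 0) (𝓝 0))
    (hD : Tendsto (fun ε => D φ κ ε (S ε)) (𝓝[>] 0) atTop)
    (hDk : (fun ε => D φ κ ε (S ε)) =o[𝓝[>] 0] fun ε => (kIndex κ ε : ℝ) ^ (1 / 2 : ℝ))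
    (hBx : OrderLE (fun ε => B φ κ ε (S ε)) fun ε => B φ κ ε (S ε) - x ε) :
    (fun ε => √(2 * |Real.log (typeII P W φ κ ε (x ε) (S ε))|)) ~[𝓝[>] 0]
      fun ε => B φ κ ε (S ε) - x ε := by
  have hB := hκ.A_bounds.tendsto_B hD
  have hy := tendsto_atTop_of_orderLE hB hBx
  have hweight_B := hκ.tendsto_weight_zero_mul ((hκ.A_bounds.isBigO_B S).trans_isLittleO hDk)
  have hweight := tendsto_weight_zero_of_mul_le hB (hweight_B.eventually_le_const one_pos)
  have hweight_y : Tendsto (fun ε => weight κ ε 0 * (B φ κ ε (S ε) - x ε)) (𝓝[>] 0) (𝓝 0) :=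
    squeeze_zero'
      ((hy.eventually_ge_atTop 0).mono fun _ hnonneg => mul_nonneg (weight_nonneg 0) hnonneg)
      ((hκ.eventually_sub_le hW hφ hweight hα S).mono fun _ hle =>
        mul_le_mul_of_nonneg_left hle (weight_nonneg 0)) hweight_B
  have heq := hκ.eventually_typeII_eq hW hφ x S
  exact isEquivalent_sqrt_abs_log hy (tendsto_log_tail_div_sq
    ((hκ.eventually_nearGaussian hW hφ S).mono fun _ h => h.neg) hy hweight_y hweight_B
    (heq.mono fun _ h => (measureReal_lt_le_measureReal_le P _ _).trans_eq h.symm)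
    (heq.mono fun _ h => h.le))

theorem tendsto_inv_sq_mul_abs_log_typeII (hκ : IsRegularFamily κ)
    (hW : IsGaussianWhiteNoise W P) (hφ : Orthonormal ℝ fun j : ℕ => φ (j + 1)) {x : ℝ → ℝ}
    {S : ℝ → Signal} {r : ℝ → ℝ}
    (hα : Tendsto (fun ε => typeI P W φ κ ε (x ε)) (𝓝[>] 0) (𝓝 0))
    (hr : Tendsto r (𝓝[>] 0) atTop)
    (hrk : OrderLE r fun ε => (kIndex κ ε : ℝ) ^ (1 / 2 : ℝ))
    (hBr : Tendsto (fun ε => B φ κ ε (S ε) / r ε) (𝓝[>] 0) atTop)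
    (hBx : OrderLE (fun ε => B φ κ ε (S ε)) fun ε => B φ κ ε (S ε) - x ε) :
    Tendsto (fun ε => (r ε ^ 2)⁻¹ * |Real.log (typeII P W φ κ ε (x ε) (S ε))|)
      (𝓝[>] 0) atTop := by
  obtain ⟨C, hC, hB_le⟩ := hBx
  obtain ⟨C', hC', hr_le⟩ := hrk
  obtain ⟨K, hK, hweight_le⟩ := hκ.exists_weight_zero_mul_le
  have hweight_r : ∀ᶠ ε in 𝓝[>] 0, weight κ ε 0 * r ε ≤ C' * K := by
    filter_upwards [hr_le, hweight_le] with ε hrε hweight_ε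
    calc weight κ ε 0 * r ε ≤ weight κ ε 0 * (C' * (kIndex κ ε : ℝ) ^ (1 / 2 : ℝ)) :=
          mul_le_mul_of_nonneg_left hrε (weight_nonneg 0)
      _ = C' * (weight κ ε 0 * (kIndex κ ε : ℝ) ^ (1 / 2 : ℝ)) := mul_left_comm _ _ _
      _ ≤ C' * K := by gcongr
  have hx := hκ.eventually_threshold_pos hW hφ (tendsto_weight_zero_of_mul_le hr hweight_r) hα
  exact tendsto_inv_sq_mul_abs_log_atTop
    ((hκ.eventually_nearGaussian hW hφ S).mono fun _ h => h.neg) hr (mul_pos hC' hK) hweight_r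
    hBr hC hB_le (hκ.eventually_typeII_pos hW hφ hx S)
    ((hκ.eventually_typeII_eq hW hφ x S).mono fun _ h => h.le)

end IsRegularFamily

end NeymanTest

open NeymanTest in
theorem mainTheorem9_general {Ω : Type*} [MeasurableSpace Ω] (P : Measure Ω)
    [IsProbabilityMeasure P]
    (W : Signal → Ω → ℝ) (hW : IsGaussianWhiteNoise W P)
    (φ : ℕ → Signal) (hφ : Orthonormal ℝ (fun j : ℕ => φ (j + 1)))
    (κ : ℝ → ℕ → ℝ) (hκ : ∀ ε > 0, Summable (fun j : ℕ => κ ε (j + 1) ^ 2))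
    (hA1 : AssumptionA1 κ) (hA2 : AssumptionA2 κ)
    (hκ_one : (fun ε => κ ε 1 ^ 2) =O[𝓝[>] 0] fun ε => kappaSq κ ε) :
    (∀ x : ℝ → ℝ, Tendsto x (𝓝[>] 0) atTop →
      x =o[𝓝[>] 0] (fun ε => (kIndex κ ε : ℝ) ^ (1 / 6 : ℝ)) →
      (fun ε => typeI P W φ κ ε (x ε)) ~[𝓝[>] 0] (fun ε => 1 - Phi (x ε))) ∧
    (∀ (x : ℝ → ℝ) (S : ℝ → Signal),
      Tendsto (fun ε => typeI P W φ κ ε (x ε)) (𝓝[>] 0) (𝓝 0) →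
      Tendsto (fun ε => D φ κ ε (S ε)) (𝓝[>] 0) atTop →
      (fun ε => D φ κ ε (S ε)) =o[𝓝[>] 0] (fun ε => (kIndex κ ε : ℝ) ^ (1 / 6 : ℝ)) →
      OrderLE (fun ε => B φ κ ε (S ε)) (fun ε => B φ κ ε (S ε) - x ε) →
      (fun ε => typeII P W φ κ ε (x ε) (S ε)) ~[𝓝[>] 0]
        (fun ε => Phi (x ε - B φ κ ε (S ε)))) ∧
    (∀ x : ℝ → ℝ, Tendsto x (𝓝[>] 0) atTop →
      x =o[𝓝[>] 0] (fun ε => (kIndex κ ε : ℝ) ^ (1 / 2 : ℝ)) →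
      (fun ε => √(2 * |Real.log (typeI P W φ κ ε (x ε))|)) ~[𝓝[>] 0] x ∧
      Tendsto (fun ε => typeI P W φ κ ε (x ε)) (𝓝[>] 0) (𝓝 0)) ∧
    (∀ (x : ℝ → ℝ) (S : ℝ → Signal),
      Tendsto (fun ε => typeI P W φ κ ε (x ε)) (𝓝[>] 0) (𝓝 0) →
      Tendsto (fun ε => D φ κ ε (S ε)) (𝓝[>] 0) atTop →
      (fun ε => D φ κ ε (S ε)) =o[𝓝[>] 0] (fun ε => (kIndex κ ε : ℝ) ^ (1 / 2 : ℝ)) →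
      OrderLE (fun ε => B φ κ ε (S ε)) (fun ε => B φ κ ε (S ε) - x ε) →
      (fun ε => √(2 * |Real.log (typeII P W φ κ ε (x ε) (S ε))|)) ~[𝓝[>] 0]
        (fun ε => B φ κ ε (S ε) - x ε)) ∧
    (∀ (x : ℝ → ℝ) (S : ℝ → Signal) (r : ℝ → ℝ),
      Tendsto (fun ε => typeI P W φ κ ε (x ε)) (𝓝[>] 0) (𝓝 0) →
      Tendsto r (𝓝[>] 0) atTop →
      OrderLE r (fun ε => (kIndex κ ε : ℝ) ^ (1 / 2 : ℝ)) →
      Tendsto (fun ε => B φ κ ε (S ε) / r ε) (𝓝[>] 0) atTop →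
      OrderLE (fun ε => B φ κ ε (S ε)) (fun ε => B φ κ ε (S ε) - x ε) →
      Tendsto (fun ε => (r ε ^ 2)⁻¹ * |Real.log (typeII P W φ κ ε (x ε) (S ε))|)
        (𝓝[>] 0) atTop) := by
  have hreg : IsRegularFamily κ := ⟨hκ, hA1, hA2, hκ_one⟩
  refine ⟨fun x hx hxk => ?_, fun x S hα hD hDk hBx => ?_, fun x hx hxk => ?_,
    fun x S hα hD hDk hBx => ?_, fun x S r hα hr hrk hBr hBx => ?_⟩
  · exact hreg.isEquivalent_typeI hW hφ hx hxk
  · exact hreg.isEquivalent_typeII hW hφ hα hD hDk hBx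
  · exact hreg.isEquivalent_sqrt_log_typeI hW hφ hx hxk
  · exact hreg.isEquivalent_sqrt_log_typeII hW hφ hα hD hDk hBx
  · exact hreg.tendsto_inv_sq_mul_abs_log_typeII hW hφ hα hr hrk hBr hBx

open NeymanTest in
theorem mainTheorem9 {Ω : Type*} [MeasurableSpace Ω] (P : Measure Ω) [IsProbabilityMeasure P]
    (W : Signal → Ω → ℝ) (hW : IsGaussianWhiteNoise W P)
    (φ : ℕ → Signal) (hφ : Orthonormal ℝ (fun j : ℕ => φ (j + 1)))
    (κ : ℝ → ℕ → ℝ) (hκ : ∀ ε > 0, Summable (fun j : ℕ => κ ε (j + 1) ^ 2))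
    (hA1 : AssumptionA1 κ) (hA2 : AssumptionA2 κ) (hA3 : AssumptionA3 κ) (hA4 : AssumptionA4 κ) :
    -- type I error, sharp asymptotics
    (∀ x : ℝ → ℝ, Tendsto x (𝓝[>] 0) atTop →
      x =o[𝓝[>] 0] (fun ε => (kIndex κ ε : ℝ) ^ (1 / 6 : ℝ)) →
      (fun ε => typeI P W φ κ ε (x ε)) ~[𝓝[>] 0] (fun ε => 1 - Phi (x ε))) ∧
    -- type II error, sharp asymptotics
    (∀ (x : ℝ → ℝ) (S : ℝ → Signal),
      Tendsto (fun ε => typeI P W φ κ ε (x ε)) (𝓝[>] 0) (𝓝 0) →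
      OrderLE x (fun ε => B φ κ ε (S ε)) →
      Tendsto (fun ε => D φ κ ε (S ε)) (𝓝[>] 0) atTop →
      (fun ε => D φ κ ε (S ε)) =o[𝓝[>] 0] (fun ε => (kIndex κ ε : ℝ) ^ (1 / 6 : ℝ)) →
      OrderLE (fun ε => B φ κ ε (S ε)) (fun ε => B φ κ ε (S ε) - x ε) →
      (fun ε => typeII P W φ κ ε (x ε) (S ε)) ~[𝓝[>] 0]
        (fun ε => Phi (x ε - B φ κ ε (S ε)))) ∧
    -- type I error, logarithmic asymptotics
    (∀ x : ℝ → ℝ, Tendsto x (𝓝[>] 0) atTop →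
      x =o[𝓝[>] 0] (fun ε => (kIndex κ ε : ℝ) ^ (1 / 2 : ℝ)) →
      (fun ε => √(2 * |Real.log (typeI P W φ κ ε (x ε))|)) ~[𝓝[>] 0] x ∧
      Tendsto (fun ε => typeI P W φ κ ε (x ε)) (𝓝[>] 0) (𝓝 0)) ∧
    -- type II error, logarithmic asymptotics
    (∀ (x : ℝ → ℝ) (S : ℝ → Signal),
      Tendsto (fun ε => typeI P W φ κ ε (x ε)) (𝓝[>] 0) (𝓝 0) →
      OrderLE x (fun ε => B φ κ ε (S ε)) →
      Tendsto (fun ε => D φ κ ε (S ε)) (𝓝[>] 0) atTop →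
      (fun ε => D φ κ ε (S ε)) =o[𝓝[>] 0] (fun ε => (kIndex κ ε : ℝ) ^ (1 / 2 : ℝ)) →
      OrderLE (fun ε => B φ κ ε (S ε)) (fun ε => B φ κ ε (S ε) - x ε) →
      (fun ε => √(2 * |Real.log (typeII P W φ κ ε (x ε) (S ε))|)) ~[𝓝[>] 0]
        (fun ε => B φ κ ε (S ε) - x ε)) ∧
    -- type II error, signals of larger order
    (∀ (x : ℝ → ℝ) (S : ℝ → Signal) (r : ℝ → ℝ),
      Tendsto (fun ε => typeI P W φ κ ε (x ε)) (𝓝[>] 0) (𝓝 0) →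
      OrderLE x (fun ε => B φ κ ε (S ε)) →
      Tendsto r (𝓝[>] 0) atTop →
      OrderLE r (fun ε => (kIndex κ ε : ℝ) ^ (1 / 2 : ℝ)) →
      Tendsto (fun ε => B φ κ ε (S ε) / r ε) (𝓝[>] 0) atTop →
      OrderLE (fun ε => B φ κ ε (S ε)) (fun ε => B φ κ ε (S ε) - x ε) →
      Tendsto (fun ε => (r ε ^ 2)⁻¹ * |Real.log (typeII P W φ κ ε (x ε) (S ε))|)
        (𝓝[>] 0) atTop) := by
  obtain ⟨h₁, h₂, h₃, h₄, h₅⟩ := mainTheorem9_general P W hW φ hφ κ hκ hA1 hA2 hA4.1.isBigO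
  exact ⟨h₁, fun x S hα _ => h₂ x S hα, h₃, fun x S hα _ => h₄ x S hα,
    fun x S r hα _ => h₅ x S r hα⟩
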